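/- **Setting.** Let $(\Omega,\mathcal F,\mathbb P)$ be a probability space, let $T,m\ge 1$ be integers, and let $|\cdot|$ denote Euclidean norms. For $e=(e_1,\dots,e_T)\in\mathbb R^{T\times m}$ (with $e_t\in\mathbb R^m$) write $e^t=(e_1,\dots,e_t)$. Assume the following. 1. *Factors.* $\varepsilon_1,\dots,\varepsilon_T$ are independent bounded $\mathbb R^m$-valued random variables. $\mathcal F^\varepsilon_t$ is the $\mathbb P$-completion of $\sigma(\varepsilon_1,\dots,\varepsilon_t)$, with $\mathcal F^\varepsilon_0$ the $\mathbb P$-trivial $\sigma$-algebra. $\hat\varepsilon$ is uniformly distributed on $[0,1]$ and independent of $(\varepsilon_1,\dots,\varepsilon_T)$. $\Upsilon:[0,1]\to\mathbb R^{T\times m}$ is a Borel function such that $(\hat\varepsilon_1,\dots,\hat\varepsilon_T):=\Upsilon(\hat\varepsilon)$ has the same law as $(\varepsilon_1,\dots,\varepsilon_T)$ (such a function always exists). 2. *Prices.* $S_0$ is constant and $\Delta S_t:=S_t-S_{t-1}=f_t(\varepsilon_1,\dots,\varepsilon_t)$ for $1\le t\le T$, where for some $C_f>0$ and $0<\chi\le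 1$ the functions $f_t:\mathbb R^{t\times m}\to\mathbb R$ satisfy $|f_t|\le C_f$ and $|f_t(e^t)-f_t(\bar e^t)|\le C_f|e^t-\bar e^t|^\chi$ for all $e^t,\bar e^t\in\mathbb R^{t\times m}$. 3. *Uniform no-arbitrage.* There is $0<\alpha\le 1$ such that for all $1\le t\le T$ and all $e^{t-1}\in\mathbb R^{(t-1)\times m}$, $\mathbb P[f_t(e^{t-1},\varepsilon_t)\ge\alpha]\ge\alpha$ and $\mathbb P[f_t(e^{t-1},\varepsilon_t)\le-\alpha]\ge\alpha$. 4. *Utility.* $U:\mathbb R\to\mathbb R$ is $C^2$, non-decreasing, bounded from above, and $U''<0$ everywhere. 5. *Gain-loss function.* $\nu:\mathbb R\to\mathbb R$ is $C^2$ and bounded from above, $\nu(0)=0$, $\nu''$ is bounded, and for some $k_->0$: $\nu(x)=k_-x$ for $x\le 0$, while on $(0,\infty)$ the derivative $\nu'$ is non-increasing and $0<\nu'<k_-$. Let $\Phi$ be the set of predictable strategies $\phi=(\phi_1,\dots,\phi_T)$, that is, each $\phi_t$ is a real $\mathcal F^\varepsilon_{t-1}$-measurable random variable. For $x_0\in\mathbb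 R$ and $\phi,\psi\in\Phi$ put $W_T(x_0,\psi)=x_0+\sum_{t=1}^T\psi_t\Delta S_t$ and $$B(\phi)=x_0+\sum_{t=1}^T\varphi_t(\hat\varepsilon_1,\dots,\hat\varepsilon_{t-1})\,f_t(\hat\varepsilon_1,\dots,\hat\varepsilon_t),$$ where the $\varphi_t:\mathbb R^{(t-1)\times m}\to\mathbb R$ are Borel functions with $\phi_t=\varphi_t(\varepsilon_1,\dots,\varepsilon_{t-1})$ a.s. (they exist by Doob's theorem, and $B(\phi)$ does not depend on their choice up to null sets). Let $U(x,b)=U(x)+\nu(U(x)-U(b))$ and $$u(x_0,\phi)=\sup_{\psi\in\Phi}\mathbb E\bigl[U(W_T(x_0,\psi),B(\phi))\bigr],$$ where the expectations are of random variables bounded from above and take values in $[-\infty,\infty)$. **Proposition.** There is a continuous function $C:\mathbb R\to(0,\infty)$ such that for every $x_0\in\mathbb R$ and every $\phi\in\Phi$ the following hold. * There is an optimizer $\psi^*=\psi^*(\phi)(\cdot,x_0)\in\Phi$, that is, $\mathbb E[U(W_T(x_0,\psi^*),B(\phi))]=u(x_0,\phi)$, and this expectation is finite. It is unique: every $\psi\in\Phi$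 with $\mathbb E[U(W_T(x_0,\psi),B(\phi))]=u(x_0,\phi)$ satisfies $\psi_t=\psi^*_t$ a.s. for all $1\le t\le T$. * $\psi^*$ can be represented as $\psi^*_t=\bar\psi^*_t(\varepsilon_1,\dots,\varepsilon_{t-1})$, $1\le t\le T$, with Borel functions $\bar\psi^*_t:\mathbb R^{(t-1)\times m}\to\mathbb R$ ($\bar\psi^*_1$ is a constant) such that for all $1\le t\le T$ and all $e^{t-1},\bar e^{t-1}\in\mathbb R^{(t-1)\times m}$ $$|\bar\psi^*_t(e^{t-1})|\le C(x_0),\qquad |\bar\psi^*_t(e^{t-1})-\bar\psi^*_t(\bar e^{t-1})|\le C(x_0)\,|e^{t-1}-\bar e^{t-1}|^{\chi/2^{T-t+1}}.$$ In particular the constant $C(x_0)$ depends, for the given market and preferences, only on $x_0$ and not on $\phi$. -/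

import Mathlib

open MeasureTheory ProbabilityTheory Filter
open scoped ENNReal

namespace RefMarket

/-- The space `ℝ^m` of a single factor, with the Euclidean norm. -/
abbrev Factor (m : ℕ) : Type := EuclideanSpace ℝ (Fin m)

/-- The space `ℝ^{t × m}` of factor paths `(e_1, …, e_t)`, with the Euclidean norm
`|e| = (∑ |e_i|²)^{1/2}`. -/
abbrev Path (m t : ℕ) : Type := PiLp 2 (fun _ : Fin t => Factor m)

/-- The first `t` entries `e^t` of a path `e` of length `T`. -/
def Path.restrict {m T : ℕ} (e : Path m T) (t : ℕ) (ht : t ≤ T) : Path m t :=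
  WithLp.toLp 2 fun i => e (Fin.castLE ht i)

/-- The path `(o, z)` obtained from `o = (o_1, …, o_t)` by appending one more factor `z`. -/
def Path.append {m t : ℕ} (o : Path m t) (z : Factor m) : Path m (t + 1) :=
  WithLp.toLp 2 (Fin.snoc (α := fun _ => Factor m) (fun i => o i) z)

/-- The whole random path `ε^T = (ε_1, …, ε_T)`. Throughout, trading periods are indexed by
`t : Fin T`; the index `t` stands for the period that the usual numbering calls `t + 1`. -/
def path {Ω : Type*} {m T : ℕ} (ε : Fin T → Ω → Factor m) (ω : Ω) : Path m T :=
  WithLp.toLp 2 fun i => ε i ω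

/-- The past `(ε_1, …, ε_t)` available when the position for period `t : Fin T` is chosen
(it has `t` entries, so it is empty for the first period). -/
def past {Ω : Type*} {m T : ℕ} (ε : Fin T → Ω → Factor m) (t : Fin T) (ω : Ω) : Path m t :=
  (path ε ω).restrict t t.isLt.le

/-! ### Information, strategies, wealth -/

section Market

variable {Ω : Type*} [MeasurableSpace Ω] {m T : ℕ}

/-- The `P`-completed sigma-algebra generated by the first `t` factors. For `t = 0` it consists of
the `P`-null sets and their complements. -/
@[reducible]
def information (P : Measure Ω) (ε : Fin T → Ω → Factor m) (t : ℕ) : MeasurableSpace Ω :=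
  eventuallyMeasurableSpace
    (⨆ (s : Fin T) (_ : (s : ℕ) < t), MeasurableSpace.comap (ε s) inferInstance) (ae P)

/-- The set `Φ` of predictable strategies: the position for period `t : Fin T` is measurable with
respect to the completed sigma-algebra of the factors of the strictly earlier periods. -/
structure Strategy (P : Measure Ω) (ε : Fin T → Ω → Factor m) where
  position : Fin T → Ω → ℝ
  predictable : ∀ t : Fin T, Measurable[information P ε t] (position t)

/-- Terminal wealth `W_T(x₀, ψ) = x₀ + ∑_t ψ_t ΔS_t` of a self-financing strategy, where
`S : Fin (T + 1) → Ω → ℝ` is the price process. -/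
def terminalWealth {P : Measure Ω} {ε : Fin T → Ω → Factor m} (S : Fin (T + 1) → Ω → ℝ)
    (x₀ : ℝ) (ψ : Strategy P ε) (ω : Ω) : ℝ :=
  x₀ + ∑ t : Fin T, ψ.position t ω * (S t.succ ω - S t.castSucc ω)

/-- A function that is measurable for the completion of a sigma-algebra agrees almost surely with
a function that is measurable for the sigma-algebra itself. -/
theorem exists_measurable_ae_eq {P : Measure Ω} (m₀ : MeasurableSpace Ω) {g : Ω → ℝ}
    (hg : Measurable[eventuallyMeasurableSpace m₀ (ae P)] g) :
    ∃ g' : Ω → ℝ, Measurable[m₀] g' ∧ g =ᵐ[P] g' := by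
  have h : ∀ q : ℚ, ∃ A : Set Ω, MeasurableSet[m₀] A ∧ (g ⁻¹' Set.Iio (q : ℝ)) =ᵐ[P] A :=
    fun q => hg measurableSet_Iio
  choose A hA hgA using h
  classical
  let G : Ω → EReal := fun ω => ⨅ q : ℚ, if ω ∈ A q then ((q : ℝ) : EReal) else ⊤
  refine ⟨fun ω => (G ω).toReal, ?_, ?_⟩
  · refine measurable_ereal_toReal.comp ?_
    exact Measurable.iInf fun q => Measurable.ite (hA q) measurable_const measurable_const
  · have hall : ∀ᵐ ω ∂P, ∀ q : ℚ, (g ω < (q : ℝ) ↔ ω ∈ A q) := by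
      rw [ae_all_iff]
      intro q
      exact (hgA q).mem_iff
    filter_upwards [hall] with ω hω
    have hG : G ω = ((g ω : ℝ) : EReal) := by
      apply le_antisymm
      · refine le_of_forall_gt_imp_ge_of_dense fun c hc => ?_
        obtain ⟨q, hq1, hq2⟩ := EReal.exists_rat_btwn_of_lt hc
        refine (iInf_le _ q).trans ?_
        have : g ω < (q : ℝ) := by exact_mod_cast hq1
        rw [if_pos ((hω q).1 this)]
        exact hq2.le
      · refine le_iInf fun q => ?_
        split_ifs with hq
        · exact_mod_cast ((hω q).2 hq).le
        · exact le_top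
    simp [hG]

/-- Doob's theorem: every predictable position is, almost surely, a Borel function of the past. -/
theorem Strategy.exists_doob {P : Measure Ω} {ε : Fin T → Ω → Factor m} (φ : Strategy P ε)
    (t : Fin T) :
    ∃ g : Path m t → ℝ, Measurable g ∧ φ.position t =ᵐ[P] fun ω => g (past ε t ω) := by
  obtain ⟨g', hg', hφ⟩ := exists_measurable_ae_eq _ (φ.predictable t)
  have hle : (⨆ (s : Fin T) (_ : (s : ℕ) < t), MeasurableSpace.comap (ε s) inferInstance)
      ≤ MeasurableSpace.comap (past ε t) inferInstance := by
    refine iSup₂_le fun s hs => ?_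
    have hs' : ε s = (fun e : Path m t => e ⟨s, hs⟩) ∘ past ε t := rfl
    rw [hs', ← MeasurableSpace.comap_comp]
    refine MeasurableSpace.comap_mono ?_
    exact Measurable.comap_le (by fun_prop)
  obtain ⟨g, hg, rfl⟩ := Measurable.exists_eq_measurable_comp (hg'.mono hle le_rfl)
  exact ⟨g, hg, hφ⟩

/-- Borel functions `φ_t : ℝ^{(t-1) × m} → ℝ` representing a strategy through the past factors. -/
noncomputable def Strategy.doob {P : Measure Ω} {ε : Fin T → Ω → Factor m} (φ : Strategy P ε)
    (t : Fin T) : Path m t → ℝ :=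
  Classical.choose (φ.exists_doob t)

/-- There is a Borel function of a uniform variable with the law of any given random path. -/
theorem exists_copy (P : Measure Ω) [IsProbabilityMeasure P] (ε : Fin T → Ω → Factor m)
    (hε : ∀ t, Measurable (ε t)) :
    ∃ Υ : unitInterval → Path m T, Measurable Υ ∧
      Measure.map Υ volume = Measure.map (path ε) P := by
  have : Measurable (path ε) := by unfold path; fun_prop
  have : IsProbabilityMeasure (Measure.map (path ε) P) :=
    Measure.isProbabilityMeasure_map this.aemeasurable
  exact Measure.exists_measurable_map_eq _

/-- The reference point `B(φ) = x₀ + ∑_t φ_t(ε̂_1, …, ε̂_{t-1}) f_t(ε̂_1, …, ε̂_t)`: the terminal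
wealth of `φ` in the market driven by the random path `copy = (ε̂_1, …, ε̂_T)`. -/
noncomputable def referencePoint {P : Measure Ω} {ε : Fin T → Ω → Factor m}
    (f : (t : Fin T) → Path m (t + 1) → ℝ) (copy : Ω → Path m T) (x₀ : ℝ) (φ : Strategy P ε)
    (ω : Ω) : ℝ :=
  x₀ + ∑ t : Fin T, φ.doob t ((copy ω).restrict t t.isLt.le) *
    f t ((copy ω).restrict (t + 1) t.isLt)

/-! ### Assumptions on the market -/

/-- The factors are independent bounded random variables, and `εhat` is uniformly distributed on
`[0, 1]` and independent of all of them. -/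
structure IsFactorModel (P : Measure Ω) (ε : Fin T → Ω → Factor m)
    (εhat : Ω → unitInterval) : Prop where
  measurable : ∀ t, Measurable (ε t)
  indep : iIndepFun ε P
  bounded : ∃ Cε : ℝ, ∀ t, ∀ᵐ ω ∂P, ‖ε t ω‖ ≤ Cε
  measurable_hat : Measurable εhat
  uniform_hat : Measure.map εhat P = volume
  indep_hat : IndepFun εhat (path ε) P

/-- The initial price is constant and the increments of `S` are bounded `χ`-Hölder functions `f` of
the factors. -/
structure IsPriceModel (ε : Fin T → Ω → Factor m) (S : Fin (T + 1) → Ω → ℝ)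
    (f : (t : Fin T) → Path m (t + 1) → ℝ) (χ : ℝ) : Prop where
  initial : ∃ s₀ : ℝ, ∀ ω, S 0 ω = s₀
  increment : ∀ (t : Fin T) (ω : Ω),
    S t.succ ω - S t.castSucc ω = f t ((path ε ω).restrict (t + 1) t.isLt)
  exponent_pos : 0 < χ
  exponent_le : χ ≤ 1
  holder_bounded : ∃ Cf : ℝ, 0 < Cf ∧
    (∀ (t : Fin T) (e e' : Path m (t + 1)), |f t e - f t e'| ≤ Cf * ‖e - e'‖ ^ χ) ∧
    ∀ (t : Fin T) (e : Path m (t + 1)), |f t e| ≤ Cf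

/-- Uniform no-arbitrage: whatever the past, the next price move is at least `α` upwards with
probability at least `α`, and at least `α` downwards with probability at least `α`. -/
def UniformNoArbitrage (P : Measure Ω) (ε : Fin T → Ω → Factor m)
    (f : (t : Fin T) → Path m (t + 1) → ℝ) : Prop :=
  ∃ α : ℝ, 0 < α ∧ α ≤ 1 ∧ ∀ (t : Fin T) (o : Path m t),
    α ≤ P.real {ω | α ≤ f t (o.append (ε t ω))} ∧
    α ≤ P.real {ω | f t (o.append (ε t ω)) ≤ -α}

end Market

/-! ### Preferences -/

/-- Assumptions on the utility function. -/
structure IsUtility (U : ℝ → ℝ) : Prop where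
  contDiff : ContDiff ℝ 2 U
  monotone : Monotone U
  bounded_above : ∃ CU : ℝ, 0 < CU ∧ ∀ x, U x ≤ CU
  deriv2_neg : ∀ x, deriv (deriv U) x < 0

/-- Assumptions on the gain-loss function. -/
structure IsGainLoss (ν : ℝ → ℝ) : Prop where
  contDiff : ContDiff ℝ 2 ν
  zero : ν 0 = 0
  bounds : ∃ Cν : ℝ, 0 < Cν ∧ ∀ x, ν x ≤ Cν ∧ |deriv (deriv ν) x| ≤ Cν
  slope : ∃ k : ℝ, 0 < k ∧ (∀ x ≤ 0, ν x = k * x) ∧ AntitoneOn (deriv ν) (Set.Ioi 0) ∧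
    ∀ x > 0, 0 < deriv ν x ∧ deriv ν x < k

/-- Overall satisfaction `U(x, b) = U(x) + ν(U(x) - U(b))` from `x` with reference level `b`. -/
def satisfaction (U ν : ℝ → ℝ) (x b : ℝ) : ℝ :=
  U x + ν (U x - U b)

/-- The expectation `E[X] = E[X⁺] - E[X⁻]` with values in `[-∞, ∞]`. It is used here only for
random variables that are bounded from above, for which `E[X⁺] < ∞`, while `E[X] = -∞` is
possible. -/
noncomputable def expectation {Ω : Type*} [MeasurableSpace Ω] (P : Measure Ω) (X : Ω → ℝ) :
    EReal :=
  ((∫⁻ ω, ENNReal.ofReal (X ω) ∂P : ℝ≥0∞) : EReal) -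
    ((∫⁻ ω, ENNReal.ofReal (-X ω) ∂P : ℝ≥0∞) : EReal)

section Optimization

variable {Ω : Type*} [MeasurableSpace Ω] {m T : ℕ} {P : Measure Ω} {ε : Fin T → Ω → Factor m}

/-- The payoff `U(W_T(x₀, ψ), B(φ))` of the strategy `ψ` against the reference strategy `φ`. -/
noncomputable def payoff (U ν : ℝ → ℝ) (S : Fin (T + 1) → Ω → ℝ)
    (f : (t : Fin T) → Path m (t + 1) → ℝ) (copy : Ω → Path m T) (x₀ : ℝ) (φ ψ : Strategy P ε)
    (ω : Ω) : ℝ :=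
  satisfaction U ν (terminalWealth S x₀ ψ ω) (referencePoint f copy x₀ φ ω)

/-- The value `u(x₀, φ) = sup_ψ E[U(W_T(x₀, ψ), B(φ))]`. -/
noncomputable def value (U ν : ℝ → ℝ) (S : Fin (T + 1) → Ω → ℝ)
    (f : (t : Fin T) → Path m (t + 1) → ℝ) (copy : Ω → Path m T) (x₀ : ℝ) (φ : Strategy P ε) :
    EReal :=
  ⨆ ψ : Strategy P ε, expectation P (payoff U ν S f copy x₀ φ ψ)

/-- `ψ` attains the supremum in the definition of `u(x₀, φ)`. -/
def IsOptimizer (U ν : ℝ → ℝ) (S : Fin (T + 1) → Ω → ℝ)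
    (f : (t : Fin T) → Path m (t + 1) → ℝ) (copy : Ω → Path m T) (x₀ : ℝ) (φ ψ : Strategy P ε) :
    Prop :=
  expectation P (payoff U ν S f copy x₀ φ ψ) = value U ν S f copy x₀ φ

end Optimization

end RefMarket

/-! The copy that drives the reference point is independent of the market, so the law of the
reference point can be integrated out: what is maximized is the expectation of G(W_T), where G
averages the strictly concave functions x ↦ U(x, b) over b. The upper bounds on U and ν, the bounds
0 < ν' ≤ k and the Lipschitz continuity of ν' make the estimates on U(·, b) and its derivative
locally uniform in x and uniform in b. They survive averaging against any law of b, which is why no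
constant depends on φ.

The problem for G is solved by dynamic programming. What is carried backward is a value V together
with its marginal value D, a strict supergradient in wealth (`IsMarginalFamily`). In one period the
optimal position is the zero of h ↦ E[f D(x + h f)]. By no-arbitrage this function is strongly
decreasing, and the bound y D(x + y) ≤ K confines its zero to a bounded range
(`exists_marginalGain_eq_zero`). Strong monotonicity turns the first-order condition into a
quantitative implicit function theorem (`optimalPosition_holder`): the position is χ-Hölder in the
past and Lipschitz in wealth, locally uniformly in wealth. The first-order condition also makes
E[D(x + h f)] a marginal value of the same kind (`isMarginalFamily_expectedNext`), which closes the
backward induction. Since marginal values rather than values are compared, the exponent χ is not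
halved from period to period; the smaller exponents of the theorem follow from χ and boundedness
(`le_max_mul_rpow`).

For verification, consider the expected gap between the upper bound B and the current value. It is
the same for all policies at time 0, non-decreasing in time for every policy and constant for the
optimal one. This gives optimality. If a policy does equally well, its gap is constant too, and
strict concavity forces its positions to be the optimal ones almost surely. The gap is an integral
of a non-negative function, so payoffs with expectation -∞ need no separate treatment. -/

namespace RefMarket

/-! ### Concave functions of one variable -/

theorem lt_tangent_of_strictAnti_deriv {g : ℝ → ℝ} (hg : Differentiable ℝ g)
    (h : StrictAnti (deriv g)) {x y : ℝ} (hxy : x ≠ y) :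
    g y < g x + deriv g x * (y - x) := by
  rcases lt_or_gt_of_ne hxy with hlt | hlt
  · obtain ⟨c, hc, hc'⟩ := exists_deriv_eq_slope g hlt hg.continuous.continuousOn
      hg.differentiableOn
    rw [eq_div_iff (by linarith)] at hc'
    nlinarith [h hc.1]
  · obtain ⟨c, hc, hc'⟩ := exists_deriv_eq_slope g hlt hg.continuous.continuousOn
      hg.differentiableOn
    rw [eq_div_iff (by linarith)] at hc'
    nlinarith [h hc.2]

theorem le_tangent_of_antitone_deriv {g : ℝ → ℝ} (hg : Differentiable ℝ g)
    (h : Antitone (deriv g)) (x y : ℝ) :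
    g y ≤ g x + deriv g x * (y - x) := by
  rcases lt_trichotomy x y with hlt | rfl | hlt
  · obtain ⟨c, hc, hc'⟩ := exists_deriv_eq_slope g hlt hg.continuous.continuousOn
      hg.differentiableOn
    rw [eq_div_iff (by linarith)] at hc'
    nlinarith [h hc.1.le]
  · simp
  · obtain ⟨c, hc, hc'⟩ := exists_deriv_eq_slope g hlt hg.continuous.continuousOn
      hg.differentiableOn
    rw [eq_div_iff (by linarith)] at hc'
    nlinarith [h hc.2.le]

/-! ### Utility and gain-loss functions -/

namespace IsUtility

variable {U : ℝ → ℝ} (hU : IsUtility U)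
include hU

theorem differentiable : Differentiable ℝ U := hU.contDiff.differentiable (by norm_num)

theorem contDiff_deriv : ContDiff ℝ 1 (deriv U) :=
  ((contDiff_succ_iff_deriv (n := 1)).1 (by rw [one_add_one_eq_two]; exact hU.contDiff)).2.2

theorem differentiable_deriv : Differentiable ℝ (deriv U) :=
  hU.contDiff_deriv.differentiable (by norm_num)

theorem continuous_deriv2 : Continuous (deriv (deriv U)) :=
  hU.contDiff_deriv.continuous_deriv (by norm_num)

theorem strictAnti_deriv : StrictAnti (deriv U) := strictAnti_of_deriv_neg hU.deriv2_neg

theorem deriv_pos (x : ℝ) : 0 < deriv U x :=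
  (hU.monotone.deriv_nonneg (x := x + 1)).trans_lt (hU.strictAnti_deriv (lt_add_one x))

end IsUtility

namespace IsGainLoss

variable {ν : ℝ → ℝ} (hν : IsGainLoss ν)
include hν

theorem differentiable : Differentiable ℝ ν := hν.contDiff.differentiable (by norm_num)

theorem contDiff_deriv : ContDiff ℝ 1 (deriv ν) :=
  ((contDiff_succ_iff_deriv (n := 1)).1 (by rw [one_add_one_eq_two]; exact hν.contDiff)).2.2

theorem differentiable_deriv : Differentiable ℝ (deriv ν) :=
  hν.contDiff_deriv.differentiable (by norm_num)

/-- The derivative of a gain-loss function decreases from its value on the negative half-line. -/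
theorem deriv_bounds : ∃ k : ℝ, 0 < k ∧ (∀ x, 0 < deriv ν x ∧ deriv ν x ≤ k) ∧
    Antitone (deriv ν) := by
  obtain ⟨k, hk, hneg, hanti, hpos⟩ := hν.slope
  have hlt : ∀ x < 0, deriv ν x = k := by
    intro x hx
    have : ν =ᶠ[nhds x] fun y => k * y := by
      filter_upwards [Iio_mem_nhds hx] with y hy using hneg y (le_of_lt hy)
    rw [this.deriv_eq]
    simp
  have hle : ∀ x ≤ 0, deriv ν x = k := by
    have hc : IsClosed {x | deriv ν x = k} :=
      isClosed_eq hν.contDiff_deriv.continuous continuous_const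
    -- At 0 the formula for ν holds only on one side; the derivative there is found as a limit from
    -- the left, by continuity of ν'.
    have := closure_minimal (s := Set.Iio (0 : ℝ)) (fun x hx => hlt x hx) hc
    rw [closure_Iio] at this
    exact fun x hx => this hx
  refine ⟨k, hk, fun x => ?_, fun x y hxy => ?_⟩
  · rcases le_or_gt x 0 with hx | hx
    · rw [hle x hx]; exact ⟨hk, le_rfl⟩
    · exact ⟨(hpos x hx).1, (hpos x hx).2.le⟩
  · rcases le_or_gt x 0 with hx | hx
    · rw [hle x hx]
      rcases le_or_gt y 0 with hy | hy
      · rw [hle y hy]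
      · exact (hpos y hy).2.le
    · exact hanti hx (hx.trans_le hxy) hxy

theorem abs_deriv_sub_le : ∃ L : ℝ, 0 < L ∧ ∀ x y, |deriv ν x - deriv ν y| ≤ L * |x - y| := by
  obtain ⟨L, hL, hb⟩ := hν.bounds
  refine ⟨L, hL, fun x y => ?_⟩
  simpa [Real.norm_eq_abs] using
    Convex.norm_image_sub_le_of_norm_deriv_le (f := deriv ν) (s := Set.univ) (C := L)
      (fun z _ => hν.differentiable_deriv z) (fun z _ => (hb z).2) convex_univ
      (Set.mem_univ y) (Set.mem_univ x)

end IsGainLoss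

/-! ### Families of concave value functions -/

/-- A family, indexed by `ι`, of functions `V i e x` of a state `e` and a wealth `x` that are
bounded above by `B` and strictly concave in `x` with marginal values `D i e x > 0`. All estimates
are locally uniform in `x` and uniform in `i` and `e`: `D` is strongly decreasing, Lipschitz in `x`
and `χ`-Hölder in `e`, and grows at most like `1 / x` for large wealth. -/
structure IsMarginalFamily {ι E : Type*} [NormedAddCommGroup E] [MeasurableSpace E] (χ B : ℝ)
    (V D : ι → E → ℝ → ℝ) : Prop where
  measurable : ∀ i, Measurable fun p : E × ℝ => V i p.1 p.2
  le : ∀ i e x, V i e x ≤ B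
  bounded : ∀ R, ∃ k, ∀ i e x, |x| ≤ R → |V i e x| ≤ k
  pos : ∀ R, ∃ d > 0, ∀ i e x, |x| ≤ R → d ≤ D i e x
  marginal_le : ∀ R, ∃ M > 0, ∀ i e x, |x| ≤ R → D i e x ≤ M
  holder : ∀ R, ∃ L > 0, ∀ i e e' x x', |x| ≤ R → |x'| ≤ R →
    |D i e x - D i e' x'| ≤ L * (‖e - e'‖ ^ χ + |x - x'|)
  strongly : ∀ R, ∃ c > 0, ∀ i e x y, |x| ≤ R → |y| ≤ R →
    (D i e x - D i e y) * (x - y) ≤ -(c * (x - y) ^ 2)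
  growth : ∀ R, ∃ K > 0, ∀ i e x y, |x| ≤ R → y * D i e (x + y) ≤ K
  lt : ∀ i e x y, x ≠ y → V i e y < V i e x + D i e x * (y - x)

/-- The derivative of `satisfaction U ν · b`. -/
noncomputable def marginalSatisfaction (U ν : ℝ → ℝ) (x b : ℝ) : ℝ :=
  deriv U x * (1 + deriv ν (U x - U b))

theorem exists_abs_le_of_continuous {g : ℝ → ℝ} (hg : Continuous g) (R : ℝ) :
    ∃ M > 0, ∀ x, |x| ≤ R → |g x| ≤ M := by
  obtain ⟨M, hM⟩ := (isCompact_Icc (a := -R) (b := R)).exists_bound_of_continuousOn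
    hg.continuousOn
  exact ⟨max M 1, by positivity, fun x hx => (hM x (abs_le.1 hx)).trans (le_max_left _ _)⟩

theorem exists_pos_le_of_continuous {g : ℝ → ℝ} (hg : Continuous g) (hpos : ∀ x, 0 < g x)
    (R : ℝ) : ∃ d > 0, ∀ x, |x| ≤ R → d ≤ g x := by
  obtain ⟨M, hM, h⟩ := exists_abs_le_of_continuous (hg.inv₀ fun x => (hpos x).ne') R
  refine ⟨M⁻¹, inv_pos.2 hM, fun x hx => ?_⟩
  have := (le_abs_self _).trans (h x hx)
  exact inv_le_of_inv_le₀ (hpos x) this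

theorem exists_abs_sub_le_of_deriv {g : ℝ → ℝ} (hg : Differentiable ℝ g)
    (hg' : Continuous (deriv g)) (R : ℝ) :
    ∃ L > 0, ∀ x y, |x| ≤ R → |y| ≤ R → |g x - g y| ≤ L * |x - y| := by
  obtain ⟨L, hL, h⟩ := exists_abs_le_of_continuous hg' R
  refine ⟨L, hL, fun x y hx hy => ?_⟩
  simpa [Real.norm_eq_abs] using
    Convex.norm_image_sub_le_of_norm_deriv_le (f := g) (s := Set.Icc (-R) R) (C := L)
      (fun z _ => hg z) (fun z hz => h z (abs_le.2 hz)) (convex_Icc _ _)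
      (abs_le.1 hy) (abs_le.1 hx)

theorem measurable_satisfaction {U ν : ℝ → ℝ} (hU : IsUtility U) (hν : IsGainLoss ν) :
    Measurable fun p : ℝ × ℝ => satisfaction U ν p.1 p.2 := by
  have h1 := hU.contDiff.continuous
  have h2 := hν.contDiff.continuous
  unfold satisfaction
  exact Continuous.measurable (by fun_prop)

theorem measurable_marginalSatisfaction {U ν : ℝ → ℝ} (hU : IsUtility U) (hν : IsGainLoss ν) :
    Measurable fun p : ℝ × ℝ => marginalSatisfaction U ν p.1 p.2 := by
  have h1 := hU.contDiff.continuous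
  have h2 := hν.contDiff_deriv.continuous
  have h3 := hU.contDiff_deriv.continuous
  unfold marginalSatisfaction
  exact Continuous.measurable (by fun_prop)

/-- The tangent of ν at U x - U b bounds the left side by an expression in U y with slope 1 + ν' >
0; inserting the strict tangent of U then gives strictness. -/
theorem satisfaction_lt {U ν : ℝ → ℝ} (hU : IsUtility U) (hν : IsGainLoss ν) (b : ℝ) {x y : ℝ}
    (hxy : x ≠ y) : satisfaction U ν y b <
      satisfaction U ν x b + marginalSatisfaction U ν x b * (y - x) := by
  obtain ⟨k, hk, hb, hanti⟩ := hν.deriv_bounds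
  have h1 := lt_tangent_of_strictAnti_deriv hU.differentiable hU.strictAnti_deriv hxy
  have h2 := le_tangent_of_antitone_deriv hν.differentiable hanti (U x - U b) (U y - U b)
  have h3 := (hb (U x - U b)).1
  unfold satisfaction marginalSatisfaction
  nlinarith

/-- The satisfaction from terminal wealth is a family of value functions indexed by the reference
level. -/
theorem isMarginalFamily_satisfaction {E : Type*} [NormedAddCommGroup E] [MeasurableSpace E]
    {U ν : ℝ → ℝ} (hU : IsUtility U) (hν : IsGainLoss ν) (χ : ℝ) :
    ∃ B ≥ 0, IsMarginalFamily χ B (fun b (_ : E) x => satisfaction U ν x b)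
      (fun b (_ : E) x => marginalSatisfaction U ν x b) := by
  obtain ⟨k, hk, hb, hanti⟩ := hν.deriv_bounds
  obtain ⟨L, hL, hLip⟩ := hν.abs_deriv_sub_le
  obtain ⟨CU, hCU, hUle⟩ := hU.bounded_above
  obtain ⟨Cν, hCν, hνle⟩ := hν.bounds
  have hle : ∀ x b, satisfaction U ν x b ≤ CU + Cν := fun x b =>
    add_le_add (hUle _) (hνle _).1
  have hνmono : Monotone ν := monotone_of_deriv_nonneg hν.differentiable fun x => (hb x).1.le
  have hbdd : ∀ R, ∃ K, ∀ b x : ℝ, |x| ≤ R → |satisfaction U ν x b| ≤ K := by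
    intro R
    have hc : Continuous fun x => U x + ν (U x - CU) := by
      have h1 := hU.contDiff.continuous
      have h2 := hν.contDiff.continuous
      fun_prop
    obtain ⟨K, hK, h⟩ := exists_abs_le_of_continuous hc R
    refine ⟨max K (CU + Cν), fun b x hx => abs_le.2 ⟨?_, (hle x b).trans (le_max_right _ _)⟩⟩
    have h1 := (abs_le.1 (h x hx)).1
    -- The worst reference level is the upper bound of U, which gives a lower bound independent of
    -- b.
    have h2 : ν (U x - CU) ≤ ν (U x - U b) := hνmono (by linarith [hUle b])
    have h3 := le_max_left K (CU + Cν)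
    unfold satisfaction
    linarith
  refine ⟨CU + Cν, by positivity, ?_, fun b _ x => hle x b, ?_, ?_, ?_, ?_, ?_, ?_, ?_⟩
  · intro b
    exact (measurable_satisfaction hU hν).comp (measurable_snd.prodMk measurable_const)
  · intro R
    obtain ⟨K, hK⟩ := hbdd R
    exact ⟨K, fun b _ x hx => hK b x hx⟩
  · intro R
    obtain ⟨d, hd, h⟩ := exists_pos_le_of_continuous hU.contDiff_deriv.continuous hU.deriv_pos R
    refine ⟨d, hd, fun b _ x hx => ?_⟩
    have h1 := h x hx
    have h2 := (hb (U x - U b)).1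
    unfold marginalSatisfaction
    nlinarith
  · intro R
    obtain ⟨M, hM, h⟩ := exists_abs_le_of_continuous hU.contDiff_deriv.continuous R
    refine ⟨M * (1 + k), by positivity, fun b _ x hx => ?_⟩
    have h1 := (le_abs_self _).trans (h x hx)
    have h2 := hb (U x - U b)
    unfold marginalSatisfaction
    exact mul_le_mul h1 (by linarith) (by linarith) hM.le
  · intro R
    obtain ⟨M, hM, h⟩ := exists_abs_le_of_continuous hU.contDiff_deriv.continuous R
    obtain ⟨L₁, hL₁, hLip₁⟩ := exists_abs_sub_le_of_deriv hU.differentiable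
      hU.contDiff_deriv.continuous R
    obtain ⟨L₂, hL₂, hLip₂⟩ := exists_abs_sub_le_of_deriv hU.differentiable_deriv
      hU.continuous_deriv2 R
    refine ⟨L₂ * (1 + k) + M * (L * L₁), by positivity, fun b e e' x y hx hy => ?_⟩
    have h1 := hLip₁ x y hx hy
    have h2 := hLip₂ x y hx hy
    have h3 := hLip (U x - U b) (U y - U b)
    have h4 := hb (U x - U b)
    have h5 := h y hy
    have h6 : |deriv ν (U x - U b) - deriv ν (U y - U b)| ≤ L * (L₁ * |x - y|) := by
      refine h3.trans ?_
      -- The reference utility U b cancels, so the Lipschitz constant is uniform in b.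
      rw [sub_sub_sub_cancel_right]
      gcongr
    have key : marginalSatisfaction U ν x b - marginalSatisfaction U ν y b =
        (deriv U x - deriv U y) * (1 + deriv ν (U x - U b)) +
          deriv U y * (deriv ν (U x - U b) - deriv ν (U y - U b)) := by
      unfold marginalSatisfaction; ring
    calc _ ≤ |deriv U x - deriv U y| * |1 + deriv ν (U x - U b)| +
          |deriv U y| * |deriv ν (U x - U b) - deriv ν (U y - U b)| := by
          rw [key, ← abs_mul, ← abs_mul]; exact abs_add_le _ _
      _ ≤ L₂ * |x - y| * (1 + k) + M * (L * (L₁ * |x - y|)) := by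
          have : |1 + deriv ν (U x - U b)| ≤ 1 + k := by
            rw [abs_of_pos (by linarith)]; linarith
          gcongr
      _ = (L₂ * (1 + k) + M * (L * L₁)) * |x - y| := by ring
      _ ≤ _ := by
          gcongr
          exact le_add_of_nonneg_left (by positivity)
  · intro R
    -- The strong decrease comes from U' alone: the other factor 1 + ν' is at least 1 and itself
    -- non-increasing in x.
    obtain ⟨c, hc, h⟩ := exists_pos_le_of_continuous (g := fun x => -deriv (deriv U) x)
      hU.continuous_deriv2.neg (fun x => neg_pos.2 (hU.deriv2_neg x)) R
    have main : ∀ b x y : ℝ, |x| ≤ R → |y| ≤ R → y ≤ x →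
        marginalSatisfaction U ν x b - marginalSatisfaction U ν y b ≤ -(c * (x - y)) := by
      intro b x y hx hy hyx
      have h1 := Convex.image_sub_le_mul_sub_of_deriv_le (convex_Icc (-R) R)
        hU.differentiable_deriv.continuous.continuousOn
        hU.differentiable_deriv.differentiableOn (C := -c)
        (fun z hz => by
          have := h z (abs_le.2 (Set.mem_Icc.1 (interior_subset hz)))
          linarith) y (abs_le.1 hy) x (abs_le.1 hx) hyx
      have h2 : deriv ν (U x - U b) ≤ deriv ν (U y - U b) :=
        hanti (by linarith [hU.monotone hyx])
      have h3 := (hb (U y - U b)).1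
      have h4 := hU.deriv_pos x
      unfold marginalSatisfaction
      nlinarith [mul_nonneg hc.le (sub_nonneg.2 hyx)]
    refine ⟨c, hc, fun b _ x y hx hy => ?_⟩
    rcases le_total y x with hyx | hyx
    · nlinarith [main b x y hx hy hyx]
    · nlinarith [main b y x hy hx hyx]
  · intro R
    obtain ⟨K, hK⟩ := hbdd R
    refine ⟨max (CU + Cν + K) 1, by positivity, fun b _ x y hx => ?_⟩
    refine le_trans ?_ (le_max_left _ _)
    have h1 := hle (x + y) b
    have h2 := abs_le.1 (hK b x hx)
    rcases eq_or_ne (x + y) x with h0 | h0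
    · have : y = 0 := by linarith
      subst this
      have := hle x b
      simp only [zero_mul]
      linarith
    -- The tangent taken at x + y and evaluated at x gives y * D(x + y) < V(x + y) - V(x), and the
    -- right side is bounded because V is bounded above.
    · have h3 := satisfaction_lt hU hν b h0
      have : x - (x + y) = -y := by ring
      rw [this] at h3
      linarith
  · intro b _ x y hxy
    exact satisfaction_lt hU hν b hxy

/-! ### Integrals against probability measures -/

theorem integral_lt_integral_of_lt_on {Z : Type*} [MeasurableSpace Z] {μ : Measure Z}
    {g h : Z → ℝ} (hg : Integrable g μ) (hh : Integrable h μ)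
    (hle : ∀ z, g z ≤ h z) {A : Set Z} (hA : 0 < μ.real A) (hlt : ∀ z ∈ A, g z < h z) :
    ∫ z, g z ∂μ < ∫ z, h z ∂μ := by
  refine lt_of_le_of_ne (integral_mono hg hh hle) fun heq => ?_
  rw [integral_eq_iff_of_ae_le hg hh (Eventually.of_forall hle)] at heq
  have h0 : μ {z | ¬ g z = h z} = 0 := heq
  have : μ A ≤ μ {z | ¬ g z = h z} := measure_mono fun z hz => (hlt z hz).ne
  rw [h0] at this
  have h1 : μ A = 0 := le_antisymm this bot_le
  simp [Measure.real, h1] at hA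

section Integral

variable {Z : Type*} [MeasurableSpace Z] {μ : Measure Z} [IsProbabilityMeasure μ]

theorem integral_le_of_forall_le {g : Z → ℝ} (hg : Integrable g μ) {c : ℝ}
    (h : ∀ z, g z ≤ c) : ∫ z, g z ∂μ ≤ c := by
  simpa using integral_mono hg (integrable_const c) h

theorem le_integral_of_forall_le {g : Z → ℝ} (hg : Integrable g μ) {c : ℝ}
    (h : ∀ z, c ≤ g z) : c ≤ ∫ z, g z ∂μ := by
  simpa using integral_mono (integrable_const c) hg h

theorem abs_integral_le_of_forall_le {g : Z → ℝ} {c : ℝ} (h : ∀ z, |g z| ≤ c) :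
    |∫ z, g z ∂μ| ≤ c := by
  simpa using norm_integral_le_of_norm_le_const (μ := μ) (f := g) (C := c)
    (Eventually.of_forall h)

theorem integrable_of_measurable_of_abs_le {g : Z → ℝ} (hg : Measurable g) {c : ℝ}
    (h : ∀ z, |g z| ≤ c) : Integrable g μ :=
  Integrable.of_bound hg.aestronglyMeasurable c (Eventually.of_forall h)

/-- This is how no-arbitrage enters the estimates: A is an event of probability at least α on which
the price moves by at least α in a useful direction. -/
theorem mul_add_le_integral {g : Z → ℝ} (hg : Integrable g μ) {A : Set Z}
    (hA : MeasurableSet A) {α c l : ℝ} (hα : α ≤ μ.real A) (hc : 0 ≤ c) (h1 : ∀ z, l ≤ g z)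
    (h2 : ∀ z ∈ A, c + l ≤ g z) : c * α + l ≤ ∫ z, g z ∂μ := by
  have hi : Integrable (fun z => A.indicator (fun _ => c) z + l) μ :=
    ((integrable_const c).indicator hA).add (integrable_const l)
  calc c * α + l ≤ ∫ z, (A.indicator (fun _ => c) z + l) ∂μ := by
        rw [integral_add ((integrable_const c).indicator hA) (integrable_const l),
          integral_indicator_const c hA]
        simp only [smul_eq_mul, integral_const, probReal_univ, one_mul]
        nlinarith
    _ ≤ _ := by
        refine integral_mono hi hg fun z => ?_
        by_cases hz : z ∈ A
        · simpa [hz] using h2 z hz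
        · simpa [hz] using h1 z

end Integral

/-! ### Averaging families of value functions -/

theorem continuous_of_holder {E : Type*} [NormedAddCommGroup E] {χ : ℝ} (hχ : 0 < χ)
    {G : E → ℝ → ℝ}
    (hG : ∀ R, ∃ L > 0, ∀ e e' x x', |x| ≤ R → |x'| ≤ R →
      |G e x - G e' x'| ≤ L * (‖e - e'‖ ^ χ + |x - x'|)) :
    Continuous fun p : E × ℝ => G p.1 p.2 := by
  rw [continuous_iff_continuousAt]
  rintro ⟨e, x⟩
  -- The constants are only locally uniform in wealth, so one is fixed for a neighbourhood of x.
  obtain ⟨L, hL, h⟩ := hG (|x| + 1)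
  have hlim : Tendsto (fun p : E × ℝ => L * (‖p.1 - e‖ ^ χ + |p.2 - x|)) (nhds (e, x))
      (nhds 0) := by
    have hc : Continuous fun p : E × ℝ => L * (‖p.1 - e‖ ^ χ + |p.2 - x|) := by
      have : Continuous fun p : E × ℝ => ‖p.1 - e‖ ^ χ :=
        Continuous.rpow_const (by fun_prop) fun _ => Or.inr hχ.le
      fun_prop
    have := hc.tendsto (e, x)
    simpa [Real.zero_rpow hχ.ne'] using this
  rw [ContinuousAt, tendsto_iff_dist_tendsto_zero]
  refine squeeze_zero' (Eventually.of_forall fun _ => dist_nonneg) ?_ hlim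
  have hnear : ∀ᶠ p : E × ℝ in nhds (e, x), |p.2| < |x| + 1 :=
    (continuous_snd.abs.continuousAt (x := (e, x))).eventually_lt continuousAt_const (by simp)
  filter_upwards [hnear] with p hp
  exact h p.1 e p.2 x hp.le (by linarith)

section Family

variable {ι κ E : Type*} [NormedAddCommGroup E] [MeasurableSpace E] {χ B : ℝ}

namespace IsMarginalFamily

variable {V D : ι → E → ℝ → ℝ}

theorem marginal_pos (h : IsMarginalFamily χ B V D) (i : ι) (e : E) (x : ℝ) : 0 < D i e x := by
  obtain ⟨d, hd, h⟩ := h.pos |x|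
  exact hd.trans_le (h i e x le_rfl)

theorem abs_marginal_le (h : IsMarginalFamily χ B V D) (R : ℝ) :
    ∃ M > 0, ∀ i e x, |x| ≤ R → |D i e x| ≤ M := by
  obtain ⟨M, hM, hb⟩ := h.marginal_le R
  exact ⟨M, hM, fun i e x hx => by
    rw [abs_of_pos (h.marginal_pos i e x)]; exact hb i e x hx⟩

theorem antitone (h : IsMarginalFamily χ B V D) (i : ι) (e : E) : Antitone (D i e) := by
  intro x y hxy
  rcases hxy.eq_or_lt with rfl | hlt
  · exact le_rfl
  obtain ⟨c, hc, hs⟩ := h.strongly (max |x| |y|)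
  have := hs i e x y (le_max_left _ _) (le_max_right _ _)
  by_contra! hcon
  nlinarith [sq_nonneg (x - y), mul_nonneg hc.le (sq_nonneg (x - y)),
    mul_pos_of_neg_of_neg (sub_neg.2 hcon) (sub_neg.2 hlt)]

theorem continuous_marginal (h : IsMarginalFamily χ B V D) (hχ : 0 < χ) (i : ι) :
    Continuous fun p : E × ℝ => D i p.1 p.2 :=
  continuous_of_holder hχ fun R => by
    obtain ⟨L, hL, hb⟩ := h.holder R
    exact ⟨L, hL, fun e e' x x' hx hx' => hb i e e' x x' hx hx'⟩

/-- Each defining inequality is linear in V and D, or bounds an absolute value of such an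
expression, with constants uniform in the index; it therefore integrates with the same constants. -/
theorem average [MeasurableSpace κ] {V D : κ → E → ℝ → ℝ} (h : IsMarginalFamily χ B V D)
    (hV : Measurable fun q : (E × ℝ) × κ => V q.2 q.1.1 q.1.2)
    (hD : ∀ e x, Measurable fun b => D b e x) (β : ι → Measure κ)
    [∀ i, IsProbabilityMeasure (β i)] :
    IsMarginalFamily χ B (fun i e x => ∫ b, V b e x ∂β i) (fun i e x => ∫ b, D b e x ∂β i) := by
  have hVi : ∀ i e x, Integrable (fun b => V b e x) (β i) := fun i e x => by
    obtain ⟨k, hk⟩ := h.bounded |x|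
    exact integrable_of_measurable_of_abs_le
      (hV.comp (measurable_const.prodMk measurable_id : Measurable fun b : κ => ((e, x), b)))
      fun b => hk b e x le_rfl
  have hDi : ∀ i e x, Integrable (fun b => D b e x) (β i) := fun i e x => by
    obtain ⟨M, hM, hb⟩ := h.abs_marginal_le |x|
    exact integrable_of_measurable_of_abs_le (hD e x) fun b => hb b e x le_rfl
  refine ⟨?_, ?_, ?_, ?_, ?_, ?_, ?_, ?_, ?_⟩
  · intro i
    exact (StronglyMeasurable.integral_prod_right (f := fun (p : E × ℝ) b => V b p.1 p.2)
      hV.stronglyMeasurable).measurable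
  · intro i e x
    exact integral_le_of_forall_le (hVi i e x) fun b => h.le b e x
  · intro R
    obtain ⟨k, hk⟩ := h.bounded R
    exact ⟨k, fun i e x hx => abs_integral_le_of_forall_le fun b => hk b e x hx⟩
  · intro R
    obtain ⟨d, hd, hb⟩ := h.pos R
    exact ⟨d, hd, fun i e x hx => le_integral_of_forall_le (hDi i e x) fun b => hb b e x hx⟩
  · intro R
    obtain ⟨M, hM, hb⟩ := h.marginal_le R
    exact ⟨M, hM, fun i e x hx => integral_le_of_forall_le (hDi i e x) fun b => hb b e x hx⟩
  · intro R
    obtain ⟨L, hL, hb⟩ := h.holder R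
    refine ⟨L, hL, fun i e e' x x' hx hx' => ?_⟩
    rw [← integral_sub (hDi i e x) (hDi i e' x')]
    exact abs_integral_le_of_forall_le fun b => hb b e e' x x' hx hx'
  · intro R
    obtain ⟨c, hc, hb⟩ := h.strongly R
    refine ⟨c, hc, fun i e x y hx hy => ?_⟩
    rw [← integral_sub (hDi i e x) (hDi i e y), ← integral_mul_const]
    exact integral_le_of_forall_le (((hDi i e x).sub (hDi i e y)).mul_const _)
      fun b => hb b e x y hx hy
  · intro R
    obtain ⟨K, hK, hb⟩ := h.growth R
    refine ⟨K, hK, fun i e x y hx => ?_⟩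
    rw [← integral_const_mul]
    exact integral_le_of_forall_le ((hDi i e (x + y)).const_mul _) fun b => hb b e x y hx
  · intro i e x y hxy
    rw [← integral_mul_const, ← integral_add (hVi i e x) ((hDi i e x).mul_const _)]
    exact integral_lt_integral_of_lt_on (A := Set.univ) (hVi i e y)
      ((hVi i e x).add ((hDi i e x).mul_const _)) (fun b => (h.lt b e x y hxy).le) (by simp)
      fun b _ => h.lt b e x y hxy

end IsMarginalFamily

end Family

/-! ### One trading period -/

/-- A trading period: the state `e` moves to `a e z` where `z` has law `μ`, and the price moves by
`f (a e z)`. -/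
structure IsTransition {E E' Z : Type*} [NormedAddCommGroup E] [MeasurableSpace E]
    [NormedAddCommGroup E'] [MeasurableSpace E'] [MeasurableSpace Z] (μ : Measure Z)
    (a : E → Z → E') (f : E' → ℝ) (χ c α : ℝ) : Prop where
  measurable_next : Measurable fun p : E × Z => a p.1 p.2
  norm_next_sub : ∀ e e' z, ‖a e z - a e' z‖ = ‖e - e'‖
  measurable_increment : Measurable f
  exponent_pos : 0 < χ
  bound_pos : 0 < c
  gap_pos : 0 < α
  abs_increment_le : ∀ e, |f e| ≤ c
  holder : ∀ e e', |f e - f e'| ≤ c * ‖e - e'‖ ^ χ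
  up : ∀ e, α ≤ μ.real {z | α ≤ f (a e z)}
  down : ∀ e, α ≤ μ.real {z | f (a e z) ≤ -α}

section OnePeriod

variable {ι E E' Z : Type*} [MeasurableSpace Z]

/-- The expected marginal value of the position `h` in state `e` with wealth `x`. -/
noncomputable def marginalGain (μ : Measure Z) (a : E → Z → E') (f : E' → ℝ)
    (D : ι → E' → ℝ → ℝ) (i : ι) (e : E) (x h : ℝ) : ℝ :=
  ∫ z, f (a e z) * D i (a e z) (x + h * f (a e z)) ∂μ

open Classical in
/-- The position with vanishing expected marginal value. -/
noncomputable def optimalPosition (μ : Measure Z) (a : E → Z → E') (f : E' → ℝ)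
    (D : ι → E' → ℝ → ℝ) (i : ι) (e : E) (x : ℝ) : ℝ :=
  if h : ∃ h, marginalGain μ a f D i e x h = 0 then h.choose else 0

/-- The expectation of `G` after one period in which the position `optimalPosition` is held. -/
noncomputable def expectedNext (μ : Measure Z) (a : E → Z → E') (f : E' → ℝ)
    (D G : ι → E' → ℝ → ℝ) (i : ι) (e : E) (x : ℝ) : ℝ :=
  ∫ z, G i (a e z) (x + optimalPosition μ a f D i e x * f (a e z)) ∂μ

end OnePeriod

theorem abs_add_mul_le {x h y R H c : ℝ} (hx : |x| ≤ R) (hh : |h| ≤ H) (hy : |y| ≤ c) :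
    |x + h * y| ≤ R + H * c := by
  refine (abs_add_le _ _).trans (add_le_add hx ?_)
  rw [abs_mul]
  exact mul_le_mul hh hy (abs_nonneg _) ((abs_nonneg _).trans hh)

theorem abs_add_mul_sub_le {x x' h h' y y' H c r : ℝ} (hh : |h'| ≤ H) (hy : |y| ≤ c)
    (hyy : |y - y'| ≤ r) :
    |x + h * y - (x' + h' * y')| ≤ |x - x'| + |h - h'| * c + H * r := by
  have : x + h * y - (x' + h' * y') = (x - x') + (h - h') * y + h' * (y - y') := by ring
  rw [this]
  refine (abs_add_le _ _).trans (add_le_add ((abs_add_le _ _).trans (add_le_add le_rfl ?_)) ?_)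
  · rw [abs_mul]; gcongr
  · rw [abs_mul]
    exact mul_le_mul hh hyy (abs_nonneg _) ((abs_nonneg _).trans hh)

namespace IsTransition

variable {ι E E' Z : Type*} [NormedAddCommGroup E] [MeasurableSpace E]
  [NormedAddCommGroup E'] [MeasurableSpace E'] [MeasurableSpace Z] {μ : Measure Z}
  {a : E → Z → E'} {f : E' → ℝ} {χ c α B : ℝ} {V D : ι → E' → ℝ → ℝ}

theorem measurable_next_right (ht : IsTransition μ a f χ c α) (e : E) : Measurable (a e) :=
  ht.measurable_next.comp (measurable_const.prodMk measurable_id)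

theorem measurable_comp (ht : IsTransition μ a f χ c α) (e : E) :
    Measurable fun z => f (a e z) :=
  ht.measurable_increment.comp (ht.measurable_next_right e)

theorem measurable_value (ht : IsTransition μ a f χ c α) (hV : IsMarginalFamily χ B V D) (i : ι)
    (e : E) (x h : ℝ) : Measurable fun z => V i (a e z) (x + h * f (a e z)) :=
  (hV.measurable i).comp ((ht.measurable_next_right e).prodMk
    (measurable_const.add (measurable_const.mul (ht.measurable_comp e))))

theorem integrable_value [IsProbabilityMeasure μ] (ht : IsTransition μ a f χ c α)
    (hV : IsMarginalFamily χ B V D) (i : ι) (e : E) (x h : ℝ) :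
    Integrable (fun z => V i (a e z) (x + h * f (a e z))) μ := by
  obtain ⟨k, hk⟩ := hV.bounded (|x| + |h| * c)
  exact integrable_of_measurable_of_abs_le (ht.measurable_value hV i e x h)
    fun z => hk i _ _ (abs_add_mul_le le_rfl le_rfl (ht.abs_increment_le _))

theorem measurable_marginal [BorelSpace E'] [SecondCountableTopology E']
    (ht : IsTransition μ a f χ c α)
    (hV : IsMarginalFamily χ B V D) (i : ι) (e : E) (x h : ℝ) :
    Measurable fun z => D i (a e z) (x + h * f (a e z)) :=
  (hV.continuous_marginal ht.exponent_pos i).measurable.comp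
    ((ht.measurable_next_right e).prodMk
      (measurable_const.add (measurable_const.mul (ht.measurable_comp e))))

variable [BorelSpace E'] [SecondCountableTopology E'] [IsProbabilityMeasure μ]

theorem integrable_marginal (ht : IsTransition μ a f χ c α)
    (hV : IsMarginalFamily χ B V D) (i : ι) (e : E) (x h : ℝ) :
    Integrable (fun z => D i (a e z) (x + h * f (a e z))) μ := by
  obtain ⟨k, -, hk⟩ := hV.abs_marginal_le (|x| + |h| * c)
  exact integrable_of_measurable_of_abs_le (ht.measurable_marginal hV i e x h)
    fun z => hk i _ _ (abs_add_mul_le le_rfl le_rfl (ht.abs_increment_le _))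

theorem integrable_mul_marginal (ht : IsTransition μ a f χ c α)
    (hV : IsMarginalFamily χ B V D) (i : ι) (e : E) (x h : ℝ) :
    Integrable (fun z => f (a e z) * D i (a e z) (x + h * f (a e z))) μ := by
  obtain ⟨k, -, hk⟩ := hV.abs_marginal_le (|x| + |h| * c)
  refine integrable_of_measurable_of_abs_le (c := c * k)
    ((ht.measurable_comp e).mul (ht.measurable_marginal hV i e x h)) fun z => ?_
  rw [abs_mul]
  exact mul_le_mul (ht.abs_increment_le _) (hk i _ _ (abs_add_mul_le le_rfl le_rfl (ht.abs_increment_le _)))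
    (abs_nonneg _) ht.bound_pos.le

omit [BorelSpace E'] [SecondCountableTopology E'] [IsProbabilityMeasure μ] in
/-- With probability at least `α`, the price moves in the direction in which a gain from the
position `k` adds up with `y`. -/
theorem exists_measurableSet_abs_add_mul_le (ht : IsTransition μ a f χ c α) (e : E) (y k : ℝ) :
    ∃ A, MeasurableSet A ∧ α ≤ μ.real A ∧
      ∀ z ∈ A, |y| + |k| * α ≤ |y + k * f (a e z)| := by
  have hα := ht.gap_pos
  rcases le_total 0 (y * k) with hyk | hyk
  · refine ⟨_, measurableSet_le measurable_const (ht.measurable_comp e), ht.up e, fun z hz => ?_⟩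
    have hz' : α ≤ f (a e z) := hz
    have h1 : |y + k * f (a e z)| = |y| + |k * f (a e z)| := by
      rw [abs_add_eq_add_abs_iff]
      rcases mul_nonneg_iff.1 hyk with h | h
      · exact Or.inl ⟨h.1, mul_nonneg h.2 (hα.le.trans hz')⟩
      · exact Or.inr ⟨h.1, mul_nonpos_of_nonpos_of_nonneg h.2 (hα.le.trans hz')⟩
    rw [h1, abs_mul]
    gcongr
    exact hz'.trans (le_abs_self _)
  · refine ⟨_, measurableSet_le (ht.measurable_comp e) measurable_const, ht.down e, fun z hz => ?_⟩
    have hz' : f (a e z) ≤ -α := hz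
    have h0 : f (a e z) ≤ 0 := by linarith
    have h1 : |y + k * f (a e z)| = |y| + |k * f (a e z)| := by
      rw [abs_add_eq_add_abs_iff]
      rcases mul_nonpos_iff.1 hyk with h | h
      · exact Or.inl ⟨h.1, mul_nonneg_of_nonpos_of_nonpos h.2 h0⟩
      · exact Or.inr ⟨h.1, mul_nonpos_of_nonneg_of_nonpos h.2 h0⟩
    rw [h1, abs_mul]
    gcongr
    exact le_trans (by linarith) (neg_le_abs _)

/-- The two wealths compared differ by (h - h') f. Strong decrease of D makes the integrand at most
-s (h - h')² f², and f² ≥ α² with probability at least α; hence the constant s α³. -/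
theorem marginalGain_strongly (ht : IsTransition μ a f χ c α) (hV : IsMarginalFamily χ B V D)
    (R H : ℝ) : ∃ s > 0, ∀ i e x h h', |x| ≤ R → |h| ≤ H → |h'| ≤ H →
      (marginalGain μ a f D i e x h - marginalGain μ a f D i e x h') * (h - h') ≤
        -(s * (h - h') ^ 2) := by
  obtain ⟨s, hs, hb⟩ := hV.strongly (R + H * c)
  have hα := ht.gap_pos
  refine ⟨s * α ^ 3, by positivity, fun i e x h h' hx hh hh' => ?_⟩
  obtain ⟨A, hA, hAα, hAle⟩ := ht.exists_measurableSet_abs_add_mul_le e 0 (h - h')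
  have hi := ((ht.integrable_mul_marginal hV i e x h).sub
    (ht.integrable_mul_marginal hV i e x h')).mul_const (h - h')
  have key := mul_add_le_integral (c := s * ((h - h') ^ 2 * α ^ 2)) (l := 0) hi.neg hA hAα
    (by positivity) ?_ ?_
  · simp only [Pi.neg_apply, Pi.sub_apply] at key
    rw [integral_neg, integral_mul_const, integral_sub (ht.integrable_mul_marginal hV i e x h)
      (ht.integrable_mul_marginal hV i e x h')] at key
    unfold marginalGain
    nlinarith
  all_goals
    intro z
    have h1 := hb i (a e z) _ _ (abs_add_mul_le hx hh (ht.abs_increment_le (a e z)))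
      (abs_add_mul_le hx hh' (ht.abs_increment_le (a e z)))
    have h2 : x + h * f (a e z) - (x + h' * f (a e z)) = (h - h') * f (a e z) := by ring
    rw [h2] at h1
    simp only [Pi.neg_apply, Pi.sub_apply]
  · nlinarith [mul_nonneg hs.le (sq_nonneg ((h - h') * f (a e z)))]
  · intro hz
    have h3 := hAle z hz
    have h4 : (|h - h'| * α) ^ 2 ≤ ((h - h') * f (a e z)) ^ 2 := by
      rw [← sq_abs ((h - h') * f (a e z))]
      refine pow_le_pow_left₀ (by positivity) ?_ 2
      simpa using h3
    rw [mul_pow, sq_abs] at h4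
    have h5 := mul_le_mul_of_nonneg_left h4 hs.le
    linarith

theorem marginalGain_holder (ht : IsTransition μ a f χ c α) (hV : IsMarginalFamily χ B V D)
    (R H : ℝ) : ∃ L > 0, ∀ i e e' x x' h h', |x| ≤ R → |x'| ≤ R → |h| ≤ H → |h'| ≤ H →
      |marginalGain μ a f D i e x h - marginalGain μ a f D i e' x' h'| ≤
        L * (‖e - e'‖ ^ χ + |x - x'| + |h - h'|) := by
  obtain ⟨L, hL, hb⟩ := hV.holder (R + H * c)
  obtain ⟨M, hM, hM'⟩ := hV.abs_marginal_le (R + H * c)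
  have hc := ht.bound_pos
  refine ⟨c * (L * (2 + |H| * c + c)) + c * M, by positivity,
    fun i e e' x x' h h' hx hx' hh hh' => ?_⟩
  unfold marginalGain
  rw [← integral_sub (ht.integrable_mul_marginal hV i e x h)
    (ht.integrable_mul_marginal hV i e' x' h')]
  refine abs_integral_le_of_forall_le fun z => ?_
  have h1 := hb i (a e z) (a e' z) _ _ (abs_add_mul_le hx hh (ht.abs_increment_le (a e z)))
    (abs_add_mul_le hx' hh' (ht.abs_increment_le (a e' z)))
  have h2 := ht.holder (a e z) (a e' z)
  rw [ht.norm_next_sub] at h1 h2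
  have h3 := abs_add_mul_sub_le (x := x) (x' := x') (h := h) (hh'.trans (le_abs_self H))
    (ht.abs_increment_le (a e z)) h2
  have h4 := hM' i (a e' z) _ (abs_add_mul_le hx' hh' (ht.abs_increment_le (a e' z)))
  have h5 := ht.abs_increment_le (a e z)
  set ρ := ‖e - e'‖ ^ χ with hρ
  have hρ0 : 0 ≤ ρ := by positivity
  set y := f (a e z)
  set y' := f (a e' z)
  set d := D i (a e z) (x + h * y)
  set d' := D i (a e' z) (x' + h' * y')
  have h6 : |d - d'| ≤ L * (2 + |H| * c + c) * (ρ + |x - x'| + |h - h'|) := by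
    refine (h1.trans (mul_le_mul_of_nonneg_left (add_le_add_right h3 ρ) hL.le)).trans ?_
    rw [mul_assoc]
    refine mul_le_mul_of_nonneg_left ?_ hL.le
    have e1 := abs_nonneg (x - x')
    have e2 := abs_nonneg (h - h')
    have e3 : 0 ≤ |H| * c := by positivity
    nlinarith [mul_nonneg e3 e1, mul_nonneg e3 e2, mul_nonneg hc.le e1, mul_nonneg hc.le hρ0]
  calc |y * d - y' * d'| = |y * (d - d') + (y - y') * d'| := by congr 1; ring
    _ ≤ |y| * |d - d'| + |y - y'| * |d'| := by
      rw [← abs_mul, ← abs_mul]; exact abs_add_le _ _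
    _ ≤ c * (L * (2 + |H| * c + c) * (ρ + |x - x'| + |h - h'|)) + c * ρ * M := by gcongr
    _ ≤ _ := by
      have e1 := abs_nonneg (x - x')
      have e2 := abs_nonneg (h - h')
      nlinarith [mul_nonneg (mul_nonneg hc.le hM.le) e1, mul_nonneg (mul_nonneg hc.le hM.le) e2]

/-- For the position H, `growth` bounds the contribution of any price move by K / H. A move below -α
lowers wealth, so D is at least its lower bound d at moderate wealth and the contribution is at most
-α d, with probability at least α. For large H the losses dominate and the marginal gain is
non-positive; symmetrically it is non-negative at -H, and the intermediate value theorem applies. -/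
theorem exists_marginalGain_eq_zero (ht : IsTransition μ a f χ c α)
    (hV : IsMarginalFamily χ B V D) (R : ℝ) :
    ∃ H > 0, ∀ i e x, |x| ≤ R → ∃ h, |h| ≤ H ∧ marginalGain μ a f D i e x h = 0 := by
  obtain ⟨d, hd, hdle⟩ := hV.pos R
  obtain ⟨K, hK, hKle⟩ := hV.growth R
  have hα := ht.gap_pos
  -- The value at which the expected loss α * d * α balances the largest possible gain K / H.
  set H := K / (α ^ 2 * d) with hH
  have hH0 : 0 < H := by positivity
  have hbound : α * d * α = K / H := by rw [hH]; field_simp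
  refine ⟨H, hH0, fun i e x hx => ?_⟩
  have hgrow : ∀ z h, |h| = H → h / H * (f (a e z) * D i (a e z) (x + h * f (a e z))) ≤ K / H := by
    intro z h hh
    have := hKle i (a e z) x (h * f (a e z)) hx
    rw [div_mul_eq_mul_div]
    gcongr
    linarith
  have hup : marginalGain μ a f D i e x H ≤ 0 := by
    have := mul_add_le_integral (c := α * d + K / H) (l := -(K / H))
      (ht.integrable_mul_marginal hV i e x H).neg
      (measurableSet_le (ht.measurable_comp e) measurable_const) (ht.down e) (by positivity)
      (fun z => by
        have := hgrow z H (abs_of_pos hH0)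
        rw [div_self hH0.ne', one_mul] at this
        exact neg_le_neg this) ?_
    · simp only [Pi.neg_apply, integral_neg] at this
      unfold marginalGain
      nlinarith [mul_pos (div_pos hK hH0) hα]
    · intro z hz
      have hz' : f (a e z) ≤ -α := hz
      have h1 : d ≤ D i (a e z) (x + H * f (a e z)) :=
        (hdle i _ x hx).trans (hV.antitone i _ (by nlinarith))
      simp only [Pi.neg_apply]
      nlinarith
  have hdown : 0 ≤ marginalGain μ a f D i e x (-H) := by
    have := mul_add_le_integral (c := α * d + K / H) (l := -(K / H))
      (ht.integrable_mul_marginal hV i e x (-H))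
      (measurableSet_le measurable_const (ht.measurable_comp e)) (ht.up e) (by positivity)
      (fun z => by
        have := hgrow z (-H) (by rw [abs_neg, abs_of_pos hH0])
        rw [neg_div, div_self hH0.ne'] at this
        linarith) ?_
    · unfold marginalGain
      nlinarith [mul_pos (div_pos hK hH0) hα]
    · intro z hz
      have hz' : α ≤ f (a e z) := hz
      have h1 : d ≤ D i (a e z) (x + -H * f (a e z)) :=
        (hdle i _ x hx).trans (hV.antitone i _ (by nlinarith))
      nlinarith
  have hcont : ContinuousOn (marginalGain μ a f D i e x) (Set.Icc (-H) H) := by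
    -- With state and wealth fixed, the joint estimate reduces to a Lipschitz bound in the position.
    obtain ⟨L, hL, hb⟩ := ht.marginalGain_holder hV R H
    refine (LipschitzOnWith.of_dist_le_mul (K := L.toNNReal) fun h hh h' hh' => ?_).continuousOn
    have := hb i e e x x h h' hx hx (abs_le.2 hh) (abs_le.2 hh')
    simpa [Real.dist_eq, hL.le, Real.zero_rpow ht.exponent_pos.ne'] using this
  obtain ⟨h, hh, h0⟩ := intermediate_value_Icc' (by linarith) hcont ⟨hup, hdown⟩
  exact ⟨h, abs_le.2 hh, h0⟩

/-- The first-order condition; in particular the default value 0 in `optimalPosition` is never used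
merely for lack of a zero. -/
theorem marginalGain_optimalPosition (ht : IsTransition μ a f χ c α)
    (hV : IsMarginalFamily χ B V D) (i : ι) (e : E) (x : ℝ) :
    marginalGain μ a f D i e x (optimalPosition μ a f D i e x) = 0 := by
  obtain ⟨H, -, hH⟩ := ht.exists_marginalGain_eq_zero hV |x|
  obtain ⟨h, -, h0⟩ := hH i e x le_rfl
  have hex : ∃ h, marginalGain μ a f D i e x h = 0 := ⟨h, h0⟩
  rw [optimalPosition, dif_pos hex]
  exact hex.choose_spec

/-- The zero chosen in `optimalPosition` could a priori differ from the bounded one just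
constructed; strong monotonicity shows that there is only one. -/
theorem optimalPosition_bounded (ht : IsTransition μ a f χ c α)
    (hV : IsMarginalFamily χ B V D) (R : ℝ) :
    ∃ H > 0, ∀ i e x, |x| ≤ R → |optimalPosition μ a f D i e x| ≤ H := by
  obtain ⟨H, hH0, hH⟩ := ht.exists_marginalGain_eq_zero hV R
  refine ⟨H, hH0, fun i e x hx => ?_⟩
  obtain ⟨h, hh, h0⟩ := hH i e x hx
  have h1 := ht.marginalGain_optimalPosition hV i e x
  obtain ⟨s, hs, hb⟩ := ht.marginalGain_strongly hV R
    (max |h| |optimalPosition μ a f D i e x|)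
  have h2 := hb i e x _ _ hx (le_max_left _ _) (le_max_right _ _)
  rw [h0, h1, sub_zero, zero_mul] at h2
  have h3 : h - optimalPosition μ a f D i e x = 0 := by
    by_contra hne
    have : 0 < (h - optimalPosition μ a f D i e x) ^ 2 := by positivity
    nlinarith [mul_pos hs this]
  rwa [← sub_eq_zero.1 h3]

/-- Let g be the marginal gain in state (e, x) of the position that is optimal for (e', x'), and δ
the difference of the two optimal positions. Strong monotonicity gives s |δ|² ≤ |g| |δ|. Since the
marginal gain of that position vanishes at (e', x'), Hölder continuity bounds |g|. Dividing by |δ|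
keeps the exponent χ; a comparison of values would leave |δ|² on the left and halve it. -/
theorem optimalPosition_holder (ht : IsTransition μ a f χ c α)
    (hV : IsMarginalFamily χ B V D) (R : ℝ) :
    ∃ L > 0, ∀ i e e' x x', |x| ≤ R → |x'| ≤ R →
      |optimalPosition μ a f D i e x - optimalPosition μ a f D i e' x'| ≤
        L * (‖e - e'‖ ^ χ + |x - x'|) := by
  obtain ⟨H, -, hH⟩ := ht.optimalPosition_bounded hV R
  obtain ⟨s, hs, hstrong⟩ := ht.marginalGain_strongly hV R H
  obtain ⟨L, hL, hb⟩ := ht.marginalGain_holder hV R H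
  refine ⟨L / s, by positivity, fun i e e' x x' hx hx' => ?_⟩
  have h1 := hstrong i e x _ _ hx (hH i e x hx) (hH i e' x' hx')
  have h2 := hb i e e' x x' _ _ hx hx' (hH i e' x' hx') (hH i e' x' hx')
  rw [ht.marginalGain_optimalPosition hV] at h1 h2
  set g := marginalGain μ a f D i e x (optimalPosition μ a f D i e' x')
  set δ := optimalPosition μ a f D i e x - optimalPosition μ a f D i e' x'
  rw [sub_self, abs_zero, add_zero, sub_zero] at h2
  rw [div_mul_eq_mul_div, le_div_iff₀ hs]
  refine le_trans ?_ h2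
  have h3 : s * |δ| ^ 2 ≤ |g| * |δ| := by
    rw [sq_abs, ← abs_mul]
    refine le_trans ?_ (le_abs_self _)
    linarith
  rcases (abs_nonneg δ).eq_or_lt with h4 | h4
  · rw [← h4]; simp
  · have : (|δ| * s) * |δ| ≤ |g| * |δ| := by linarith [sq (|δ|), h3]
    exact le_of_mul_le_mul_right this h4

theorem continuous_optimalPosition (ht : IsTransition μ a f χ c α)
    (hV : IsMarginalFamily χ B V D) (i : ι) :
    Continuous fun p : E × ℝ => optimalPosition μ a f D i p.1 p.2 :=
  continuous_of_holder ht.exponent_pos fun R => by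
    obtain ⟨L, hL, hb⟩ := ht.optimalPosition_holder hV R
    exact ⟨L, hL, fun e e' x x' hx hx' => hb i e e' x x' hx hx'⟩

/-- Tangent inequality for the expected value after one period, strict unless both the wealth and
the position agree. -/
theorem integral_value_lt (ht : IsTransition μ a f χ c α) (hV : IsMarginalFamily χ B V D) (i : ι)
    (e : E) (x y h : ℝ) (hne : y ≠ x ∨ h ≠ optimalPosition μ a f D i e x) :
    ∫ z, V i (a e z) (y + h * f (a e z)) ∂μ <
      expectedNext μ a f D V i e x + expectedNext μ a f D D i e x * (y - x) := by
  have hfoc := ht.marginalGain_optimalPosition hV i e x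
  unfold expectedNext
  unfold marginalGain at hfoc
  set k := optimalPosition μ a f D i e x
  have hi1 := ht.integrable_value hV i e x k
  have hi2 := ht.integrable_marginal hV i e x k
  have hi3 := ht.integrable_mul_marginal hV i e x k
  have hα := ht.gap_pos
  -- By the first-order condition the term with h - k integrates to zero; adding it completes the
  -- integrand to the tangent of V in the terminal wealth of the period.
  have heq : ∫ z, V i (a e z) (x + k * f (a e z)) ∂μ +
      (∫ z, D i (a e z) (x + k * f (a e z)) ∂μ) * (y - x) =
      ∫ z, (V i (a e z) (x + k * f (a e z)) + (D i (a e z) (x + k * f (a e z)) * (y - x) +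
        f (a e z) * D i (a e z) (x + k * f (a e z)) * (h - k))) ∂μ := by
    have hs : Integrable (fun z => D i (a e z) (x + k * f (a e z)) * (y - x) +
        f (a e z) * D i (a e z) (x + k * f (a e z)) * (h - k)) μ :=
      (hi2.mul_const _).add (hi3.mul_const _)
    rw [integral_add hi1 hs,
      integral_add (hi2.mul_const _) (hi3.mul_const _), integral_mul_const, integral_mul_const,
      hfoc]
    ring
  rw [heq]
  have hlt : ∀ z, y + h * f (a e z) ≠ x + k * f (a e z) → V i (a e z) (y + h * f (a e z)) <
      V i (a e z) (x + k * f (a e z)) + (D i (a e z) (x + k * f (a e z)) * (y - x) +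
        f (a e z) * D i (a e z) (x + k * f (a e z)) * (h - k)) := by
    intro z hz
    have := hV.lt i (a e z) _ _ hz.symm
    nlinarith
  -- On this event the two wealths differ as soon as y ≠ x or h ≠ k, so the tangent inequality is
  -- strict with positive probability.
  obtain ⟨A, hA, hAα, hAle⟩ := ht.exists_measurableSet_abs_add_mul_le e (y - x) (h - k)
  refine integral_lt_integral_of_lt_on (ht.integrable_value hV i e y h)
    (hi1.add ((hi2.mul_const _).add (hi3.mul_const _))) (fun z => ?_) (hα.trans_le hAα)
    fun z hz => hlt z fun hcon => ?_
  · by_cases hz : y + h * f (a e z) = x + k * f (a e z)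
    · have h0 : (y - x) + (h - k) * f (a e z) = 0 := by linarith
      have h1 : D i (a e z) (x + k * f (a e z)) * (y - x) +
          f (a e z) * D i (a e z) (x + k * f (a e z)) * (h - k) =
          D i (a e z) (x + k * f (a e z)) * ((y - x) + (h - k) * f (a e z)) := by ring
      rw [h1, h0, hz]
      simp
    · exact (hlt z hz).le
  · have h0 : (y - x) + (h - k) * f (a e z) = 0 := by linarith
    have h1 := hAle z hz
    rw [h0, abs_zero] at h1
    rcases hne with h2 | h2
    · have h3 := abs_pos.2 (sub_ne_zero.2 h2)
      have h4 : 0 ≤ |h - k| * α := by positivity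
      linarith
    · have h3 := mul_pos (abs_pos.2 (sub_ne_zero.2 h2)) hα
      have h4 := abs_nonneg (y - x)
      linarith

theorem integral_value_le (ht : IsTransition μ a f χ c α) (hV : IsMarginalFamily χ B V D) (i : ι)
    (e : E) (x h : ℝ) :
    ∫ z, V i (a e z) (x + h * f (a e z)) ∂μ ≤ expectedNext μ a f D V i e x := by
  by_cases hh : h = optimalPosition μ a f D i e x
  · rw [hh, expectedNext]
  · simpa using (ht.integral_value_lt hV i e x x h (Or.inr hh)).le

theorem wealth_holder (ht : IsTransition μ a f χ c α) (hV : IsMarginalFamily χ B V D) (R : ℝ) :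
    ∃ L > 0, ∀ i e e' x x' z, |x| ≤ R → |x'| ≤ R →
      |x + optimalPosition μ a f D i e x * f (a e z) -
        (x' + optimalPosition μ a f D i e' x' * f (a e' z))| ≤
        L * (‖e - e'‖ ^ χ + |x - x'|) := by
  obtain ⟨H, hH0, hH⟩ := ht.optimalPosition_bounded hV R
  obtain ⟨L, hL, hb⟩ := ht.optimalPosition_holder hV R
  have hc := ht.bound_pos
  refine ⟨1 + L * c + H * c, by positivity, fun i e e' x x' z hx hx' => ?_⟩
  have h1 := ht.holder (a e z) (a e' z)
  rw [ht.norm_next_sub] at h1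
  have h2 := abs_add_mul_sub_le (x := x) (x' := x') (h := optimalPosition μ a f D i e x)
    (hH i e' x' hx') (ht.abs_increment_le (a e z)) h1
  have h3 := mul_le_mul_of_nonneg_right (hb i e e' x x' hx hx') hc.le
  have h4 : 0 ≤ ‖e - e'‖ ^ χ := by positivity
  have h5 := abs_nonneg (x - x')
  nlinarith [mul_nonneg hH0.le hc.le, mul_nonneg (mul_nonneg hH0.le hc.le) h5]

/-- An envelope theorem without differentiation under the integral: since E[f D] vanishes at the
optimal position, any multiple of it may be added to expressions in E[D]. This turns increments of
initial wealth into increments of next-period wealth, where the properties of D apply. -/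
theorem isMarginalFamily_expectedNext [BorelSpace E] [SecondCountableTopology E]
    (ht : IsTransition μ a f χ c α) (hV : IsMarginalFamily χ B V D) :
    IsMarginalFamily χ B (expectedNext μ a f D V) (expectedNext μ a f D D) := by
  have hα := ht.gap_pos
  have hwealth : ∀ R, ∃ R', ∀ i e x z, |x| ≤ R →
      |x + optimalPosition μ a f D i e x * f (a e z)| ≤ R' := fun R => by
    obtain ⟨H, hH0, hH⟩ := ht.optimalPosition_bounded hV R
    exact ⟨R + H * c, fun i e x z hx => abs_add_mul_le hx (hH i e x hx) (ht.abs_increment_le _)⟩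
  refine ⟨?_, ?_, ?_, ?_, ?_, ?_, ?_, ?_, ?_⟩
  · intro i
    have hm : Measurable fun q : (E × ℝ) × Z => V i (a q.1.1 q.2)
        (q.1.2 + optimalPosition μ a f D i q.1.1 q.1.2 * f (a q.1.1 q.2)) := by
      have h1 : Measurable fun q : (E × ℝ) × Z => a q.1.1 q.2 :=
        ht.measurable_next.comp ((measurable_fst.comp measurable_fst).prodMk measurable_snd)
      have h2 : Measurable fun q : (E × ℝ) × Z => optimalPosition μ a f D i q.1.1 q.1.2 :=
        (ht.continuous_optimalPosition hV i).measurable.comp measurable_fst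
      exact (hV.measurable i).comp (h1.prodMk ((measurable_snd.comp measurable_fst).add
        (h2.mul (ht.measurable_increment.comp h1))))
    exact (StronglyMeasurable.integral_prod_right (f := fun (p : E × ℝ) z => V i (a p.1 z)
      (p.2 + optimalPosition μ a f D i p.1 p.2 * f (a p.1 z))) hm.stronglyMeasurable).measurable
  · intro i e x
    exact integral_le_of_forall_le (ht.integrable_value hV i e x _) fun z => hV.le i _ _
  · intro R
    obtain ⟨R', hR'⟩ := hwealth R
    obtain ⟨k, hk⟩ := hV.bounded R'
    exact ⟨k, fun i e x hx => abs_integral_le_of_forall_le fun z => hk i _ _ (hR' i e x z hx)⟩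
  · intro R
    obtain ⟨R', hR'⟩ := hwealth R
    obtain ⟨d, hd, hb⟩ := hV.pos R'
    exact ⟨d, hd, fun i e x hx => le_integral_of_forall_le (ht.integrable_marginal hV i e x _)
      fun z => hb i _ _ (hR' i e x z hx)⟩
  · intro R
    obtain ⟨R', hR'⟩ := hwealth R
    obtain ⟨M, hM, hb⟩ := hV.marginal_le R'
    exact ⟨M, hM, fun i e x hx => integral_le_of_forall_le (ht.integrable_marginal hV i e x _)
      fun z => hb i _ _ (hR' i e x z hx)⟩
  · intro R
    obtain ⟨R', hR'⟩ := hwealth R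
    obtain ⟨L, hL, hb⟩ := hV.holder R'
    obtain ⟨L', hL', hb'⟩ := ht.wealth_holder hV R
    refine ⟨L * (1 + L'), by positivity, fun i e e' x x' hx hx' => ?_⟩
    unfold expectedNext
    rw [← integral_sub (ht.integrable_marginal hV i e x _) (ht.integrable_marginal hV i e' x' _)]
    refine abs_integral_le_of_forall_le fun z => ?_
    refine (hb i _ _ _ _ (hR' i e x z hx) (hR' i e' x' z hx')).trans ?_
    rw [ht.norm_next_sub, mul_assoc]
    refine mul_le_mul_of_nonneg_left ?_ hL.le
    linarith [hb' i e e' x x' z hx hx', abs_nonneg (x - x')]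
  · intro R
    obtain ⟨R', hR'⟩ := hwealth R
    obtain ⟨s, hs, hb⟩ := hV.strongly R'
    refine ⟨s * α, by positivity, fun i e x y hx hy => ?_⟩
    have hfx := ht.marginalGain_optimalPosition hV i e x
    have hfy := ht.marginalGain_optimalPosition hV i e y
    unfold expectedNext
    unfold marginalGain at hfx hfy
    have hbx : ∀ z, |x + optimalPosition μ a f D i e x * f (a e z)| ≤ R' :=
      fun z => hR' i e x z hx
    have hby : ∀ z, |y + optimalPosition μ a f D i e y * f (a e z)| ≤ R' :=
      fun z => hR' i e y z hy
    set h := optimalPosition μ a f D i e x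
    set k := optimalPosition μ a f D i e y
    have hix := ht.integrable_marginal hV i e x h
    have hiy := ht.integrable_marginal hV i e y k
    have hjx := ht.integrable_mul_marginal hV i e x h
    have hjy := ht.integrable_mul_marginal hV i e y k
    -- Both first-order conditions, multiplied by h - k, replace the factor x - y by the difference
    -- of the next-period wealths. With probability at least α that difference is no smaller than |x
    -- - y| in absolute value.
    have heq : ((∫ z, D i (a e z) (x + h * f (a e z)) ∂μ) -
        ∫ z, D i (a e z) (y + k * f (a e z)) ∂μ) * (x - y) =
        ∫ z, ((D i (a e z) (x + h * f (a e z)) - D i (a e z) (y + k * f (a e z))) * (x - y) +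
          (f (a e z) * D i (a e z) (x + h * f (a e z)) -
            f (a e z) * D i (a e z) (y + k * f (a e z))) * (h - k)) ∂μ := by
      have h1 : Integrable (fun z => (D i (a e z) (x + h * f (a e z)) -
          D i (a e z) (y + k * f (a e z))) * (x - y)) μ := (hix.sub hiy).mul_const _
      have h2 : Integrable (fun z => (f (a e z) * D i (a e z) (x + h * f (a e z)) -
          f (a e z) * D i (a e z) (y + k * f (a e z))) * (h - k)) μ := (hjx.sub hjy).mul_const _
      rw [integral_add h1 h2,
        integral_mul_const, integral_mul_const, integral_sub hix hiy, integral_sub hjx hjy,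
        hfx, hfy]
      ring
    rw [heq]
    obtain ⟨A, hA, hAα, hAle⟩ := ht.exists_measurableSet_abs_add_mul_le e (x - y) (h - k)
    have key := mul_add_le_integral (c := s * (x - y) ^ 2) (l := 0)
      (((hix.sub hiy).mul_const (x - y)).add ((hjx.sub hjy).mul_const (h - k))).neg hA hAα
      (by positivity) ?_ ?_
    · rw [integral_neg'] at key
      simp only [Pi.add_apply, Pi.sub_apply] at key
      linarith
    all_goals
      intro z
      have h1 := hb i (a e z) _ _ (hbx z) (hby z)
      simp only [Pi.neg_apply, Pi.add_apply, Pi.sub_apply]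
    · nlinarith [mul_nonneg hs.le
        (sq_nonneg (x + h * f (a e z) - (y + k * f (a e z))))]
    · intro hz
      have h2 := hAle z hz
      have h3 : |x - y| ≤ |x + h * f (a e z) - (y + k * f (a e z))| := by
        have : x + h * f (a e z) - (y + k * f (a e z)) = x - y + (h - k) * f (a e z) := by ring
        rw [this]
        have : 0 ≤ |h - k| * α := by positivity
        linarith
      have h4 := mul_le_mul_of_nonneg_left (sq_le_sq.2 h3) hs.le
      linarith
  · intro R
    obtain ⟨K, hK, hb⟩ := hV.growth R
    refine ⟨K, hK, fun i e x y hx => ?_⟩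
    have hfoc := ht.marginalGain_optimalPosition hV i e (x + y)
    unfold expectedNext
    unfold marginalGain at hfoc
    set h := optimalPosition μ a f D i e (x + y)
    have hi := ht.integrable_marginal hV i e (x + y) h
    have hj := ht.integrable_mul_marginal hV i e (x + y) h
    -- The first-order condition replaces y by y + h f, so `growth` for D applies pointwise and K is
    -- unchanged.
    have heq : y * ∫ z, D i (a e z) (x + y + h * f (a e z)) ∂μ =
        ∫ z, (y * D i (a e z) (x + y + h * f (a e z)) +
          h * (f (a e z) * D i (a e z) (x + y + h * f (a e z)))) ∂μ := by
      rw [integral_add (hi.const_mul _) (hj.const_mul _), integral_const_mul, integral_const_mul,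
        hfoc]
      ring
    rw [heq]
    refine integral_le_of_forall_le ((hi.const_mul _).add (hj.const_mul _)) fun z => ?_
    have := hb i (a e z) x (y + h * f (a e z)) hx
    rw [← add_assoc] at this
    simp only [Pi.add_apply]
    linarith
  · intro i e x y hxy
    exact ht.integral_value_lt hV i e x y _ (Or.inl hxy.symm)

end IsTransition

/-! ### Paths -/

section Paths

variable {m : ℕ}

theorem Path.norm_append_sub {t : ℕ} (o o' : Path m t) (z : Factor m) :
    ‖o.append z - o'.append z‖ = ‖o - o'‖ := by
  rw [PiLp.norm_eq_of_L2, PiLp.norm_eq_of_L2, Fin.sum_univ_castSucc]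
  simp [Path.append]

theorem Path.norm_restrict_sub_le {T : ℕ} (e e' : Path m T) (t : ℕ) (ht : t ≤ T) :
    ‖e.restrict t ht - e'.restrict t ht‖ ≤ ‖e - e'‖ := by
  rw [PiLp.norm_eq_of_L2, PiLp.norm_eq_of_L2]
  refine Real.sqrt_le_sqrt ?_
  have h : ∀ i : Fin t, ‖(e.restrict t ht - e'.restrict t ht) i‖ ^ 2 =
      (fun j : Fin T => ‖(e - e') j‖ ^ 2) (Fin.castLEEmb ht i) := fun i => rfl
  rw [Finset.sum_congr rfl fun i _ => h i]
  refine (Finset.sum_map Finset.univ (Fin.castLEEmb ht)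
    fun j : Fin T => ‖(e - e') j‖ ^ 2).symm.le.trans ?_
  exact Finset.sum_le_sum_of_subset_of_nonneg (Finset.subset_univ _) fun _ _ _ => by positivity

theorem Path.continuous_append {t : ℕ} :
    Continuous fun p : Path m t × Factor m => p.1.append p.2 := by
  refine (PiLp.continuous_toLp 2 _).comp ?_
  refine Continuous.finSnoc ?_ continuous_snd
  exact (PiLp.continuous_ofLp 2 _).comp continuous_fst

theorem Path.continuous_restrict {T : ℕ} (t : ℕ) (ht : t ≤ T) :
    Continuous fun e : Path m T => e.restrict t ht := by
  refine (PiLp.continuous_toLp 2 _).comp ?_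
  fun_prop

theorem Path.restrict_append {t : ℕ} (o : Path m t) (z : Factor m) :
    (o.append z).restrict t t.le_succ = o := by
  ext i : 1
  change (Fin.snoc (α := fun _ => Factor m) (fun i => o i) z : Fin (t + 1) → Factor m)
    i.castSucc = o i
  simp

end Paths

/-! ### Dynamic programming -/

section Dynamic

variable {ι : Type*} {m : ℕ}

/-- The value functions of the optimization problem at time `t`, and their marginal values. -/
noncomputable def valuePair (T : ℕ) (μ : ℕ → Measure (Factor m))
    (f : (t : ℕ) → Path m (t + 1) → ℝ) (G D : ι → ℝ → ℝ) (t : ℕ) :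
    (ι → Path m t → ℝ → ℝ) × (ι → Path m t → ℝ → ℝ) :=
  if t < T then
    (expectedNext (μ t) Path.append (f t) (valuePair T μ f G D (t + 1)).2
      (valuePair T μ f G D (t + 1)).1,
    expectedNext (μ t) Path.append (f t) (valuePair T μ f G D (t + 1)).2
      (valuePair T μ f G D (t + 1)).2)
  else (fun i _ x => G i x, fun i _ x => D i x)
termination_by T - t

/-- The optimal position at time `t` as a function of the past and the current wealth. -/
noncomputable def optimalPolicy (T : ℕ) (μ : ℕ → Measure (Factor m))
    (f : (t : ℕ) → Path m (t + 1) → ℝ) (G D : ι → ℝ → ℝ) (i : ι) (t : ℕ) :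
    Path m t → ℝ → ℝ :=
  optimalPosition (μ t) Path.append (f t) (valuePair T μ f G D (t + 1)).2 i

/-- The wealth at time `t` of the policy `g`, along a path. -/
def policyWealth (f : (t : ℕ) → Path m (t + 1) → ℝ) (x₀ : ℝ) (g : (t : ℕ) → Path m t → ℝ → ℝ) :
    (t : ℕ) → Path m t → ℝ
  | 0, _ => x₀
  | t + 1, e => policyWealth f x₀ g t (e.restrict t t.le_succ) +
      g t (e.restrict t t.le_succ) (policyWealth f x₀ g t (e.restrict t t.le_succ)) * f t e

variable {T : ℕ} {μ : ℕ → Measure (Factor m)} {f : (t : ℕ) → Path m (t + 1) → ℝ}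
  {G D : ι → ℝ → ℝ} {χ c α B : ℝ}

theorem isMarginalFamily_valuePair [∀ t, IsProbabilityMeasure (μ t)]
    (hM : ∀ t < T, IsTransition (μ t) Path.append (f t) χ c α)
    (hG : IsMarginalFamily χ B (fun i (_ : Path m T) x => G i x) (fun i _ x => D i x))
    {t : ℕ} (ht : t ≤ T) :
    IsMarginalFamily χ B (valuePair T μ f G D t).1 (valuePair T μ f G D t).2 := by
  induction ht using Nat.decreasingInduction with
  | self =>
    rw [valuePair, if_neg (lt_irrefl T)]
    exact hG
  | of_succ k hk ih =>
    rw [valuePair, if_pos hk]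
    exact (hM k hk).isMarginalFamily_expectedNext ih

theorem measurable_policyWealth {g : (t : ℕ) → Path m t → ℝ → ℝ} (x₀ : ℝ)
    (hf : ∀ t < T, Measurable (f t))
    (hg : ∀ t < T, Measurable fun p : Path m t × ℝ => g t p.1 p.2) :
    ∀ t ≤ T, Measurable (policyWealth f x₀ g t)
  | 0, _ => measurable_const
  | t + 1, ht => by
    have h1 := measurable_policyWealth x₀ hf hg t (Nat.le_of_succ_le ht)
    have h2 : Measurable fun e : Path m (t + 1) => e.restrict t t.le_succ :=
      (Path.continuous_restrict t t.le_succ).measurable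
    exact (h1.comp h2).add (((hg t ht).comp (h2.prodMk (h1.comp h2))).mul (hf t ht))

variable [∀ t, IsProbabilityMeasure (μ t)]

theorem optimalWealth_bounded
    (hM : ∀ t < T, IsTransition (μ t) Path.append (f t) χ c α)
    (hG : IsMarginalFamily χ B (fun i (_ : Path m T) x => G i x) (fun i _ x => D i x)) (R : ℝ) :
    ∀ t ≤ T, ∃ k, ∀ i x₀ e, |x₀| ≤ R →
      |policyWealth f x₀ (optimalPolicy T μ f G D i) t e| ≤ k
  | 0, _ => ⟨R, fun _ _ _ h => h⟩
  | t + 1, ht => by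
    obtain ⟨k, hk⟩ := optimalWealth_bounded hM hG R t (Nat.le_of_succ_le ht)
    obtain ⟨H, -, hH⟩ := (hM t ht).optimalPosition_bounded (isMarginalFamily_valuePair hM hG ht) k
    exact ⟨k + H * c, fun i x₀ e hx => abs_add_mul_le (hk i x₀ _ hx) (hH i _ _ (hk i x₀ _ hx))
      ((hM t ht).abs_increment_le e)⟩

/-- Forward induction: the position is χ-Hölder in the past and Lipschitz in wealth, so inserting a
wealth that is already χ-Hölder in the path keeps the exponent. -/
theorem optimalWealth_holder
    (hM : ∀ t < T, IsTransition (μ t) Path.append (f t) χ c α)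
    (hG : IsMarginalFamily χ B (fun i (_ : Path m T) x => G i x) (fun i _ x => D i x)) (R : ℝ) :
    ∀ t ≤ T, ∃ L > 0, ∀ i x₀ e e', |x₀| ≤ R →
      |policyWealth f x₀ (optimalPolicy T μ f G D i) t e -
        policyWealth f x₀ (optimalPolicy T μ f G D i) t e'| ≤ L * ‖e - e'‖ ^ χ
  | 0, _ => ⟨1, one_pos, fun i x₀ e e' _ => by
      simp only [policyWealth, sub_self, abs_zero]; positivity⟩
  | t + 1, ht => by
    obtain ⟨L, hL, hb⟩ := optimalWealth_holder hM hG R t (Nat.le_of_succ_le ht)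
    obtain ⟨k, hk⟩ := optimalWealth_bounded hM hG R t (Nat.le_of_succ_le ht)
    have hV := isMarginalFamily_valuePair hM hG ht
    obtain ⟨H, hH0, hH⟩ := (hM t ht).optimalPosition_bounded hV k
    obtain ⟨L', hL', hb'⟩ := (hM t ht).optimalPosition_holder hV k
    have hc := (hM t ht).bound_pos
    have hχ := (hM t ht).exponent_pos
    refine ⟨L + L' * (1 + L) * c + H * c, by positivity, fun i x₀ e e' hx => ?_⟩
    have hr : ‖e.restrict t t.le_succ - e'.restrict t t.le_succ‖ ^ χ ≤ ‖e - e'‖ ^ χ :=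
      Real.rpow_le_rpow (norm_nonneg _) (Path.norm_restrict_sub_le e e' t t.le_succ) hχ.le
    have h1 := hb i x₀ (e.restrict t t.le_succ) (e'.restrict t t.le_succ) hx
    have hk1 := hk i x₀ (e.restrict t t.le_succ) hx
    have hk2 := hk i x₀ (e'.restrict t t.le_succ) hx
    have h2 := hb' i (e.restrict t t.le_succ) (e'.restrict t t.le_succ) _ _ hk1 hk2
    refine (abs_add_mul_sub_le (hH i (e'.restrict t t.le_succ) _ hk2)
      ((hM t ht).abs_increment_le e) ((hM t ht).holder e e')).trans ?_
    have h3 := h1.trans (mul_le_mul_of_nonneg_left hr hL.le)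
    have h4 : L' * (‖e.restrict t t.le_succ - e'.restrict t t.le_succ‖ ^ χ +
        |policyWealth f x₀ (optimalPolicy T μ f G D i) t (e.restrict t t.le_succ) -
        policyWealth f x₀ (optimalPolicy T μ f G D i) t (e'.restrict t t.le_succ)|) ≤
        L' * (‖e - e'‖ ^ χ + L * ‖e - e'‖ ^ χ) := by gcongr
    have h5 := mul_le_mul_of_nonneg_right (h2.trans h4) hc.le
    refine (add_le_add_left (add_le_add h3 h5) _).trans (le_of_eq ?_)
    ring

theorem continuous_optimalPolicy
    (hM : ∀ t < T, IsTransition (μ t) Path.append (f t) χ c α)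
    (hG : IsMarginalFamily χ B (fun i (_ : Path m T) x => G i x) (fun i _ x => D i x))
    (i : ι) {t : ℕ} (ht : t < T) :
    Continuous fun p : Path m t × ℝ => optimalPolicy T μ f G D i t p.1 p.2 :=
  (hM t ht).continuous_optimalPosition (isMarginalFamily_valuePair hM hG ht) i

/-- Lowering a Hölder exponent: for r ≤ 1 the power r ^ χ' dominates r ^ χ, and for r ≥ 1 the
uniform bound suffices. -/
theorem le_max_mul_rpow {d L H r χ χ' : ℝ} (hL : 0 ≤ L) (hH : 0 ≤ H) (hr : 0 ≤ r) (hχ' : 0 < χ')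
    (hχ : χ' ≤ χ) (h1 : d ≤ L * r ^ χ) (h2 : d ≤ H) : d ≤ max L H * r ^ χ' := by
  rcases le_total r 1 with hr1 | hr1
  · rcases hr.eq_or_lt with rfl | hr0
    · rw [Real.zero_rpow (hχ'.trans_le hχ).ne', mul_zero] at h1
      rwa [Real.zero_rpow hχ'.ne', mul_zero]
    · have := Real.rpow_le_rpow_of_exponent_ge hr0 hr1 hχ
      exact h1.trans (mul_le_mul (le_max_left _ _) this (by positivity) (hL.trans (le_max_left _ _)))
  · have := Real.one_le_rpow hr1 hχ'.le
    have h3 := le_max_right L H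
    nlinarith

/-- The optimal positions along a path are bounded and Hölder continuous, locally uniformly in the
initial wealth. -/
theorem optimalPolicy_path_bounds
    (hM : ∀ t < T, IsTransition (μ t) Path.append (f t) χ c α)
    (hG : IsMarginalFamily χ B (fun i (_ : Path m T) x => G i x) (fun i _ x => D i x)) (R : ℝ)
    {t : ℕ} (ht : t < T) {χ' : ℝ} (hχ' : 0 < χ') (hχ : χ' ≤ χ) :
    ∃ C > 0, ∀ i x₀, |x₀| ≤ R →
      (∀ e, |optimalPolicy T μ f G D i t e
        (policyWealth f x₀ (optimalPolicy T μ f G D i) t e)| ≤ C) ∧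
      ∀ e e', |optimalPolicy T μ f G D i t e
          (policyWealth f x₀ (optimalPolicy T μ f G D i) t e) -
        optimalPolicy T μ f G D i t e'
          (policyWealth f x₀ (optimalPolicy T μ f G D i) t e')| ≤ C * ‖e - e'‖ ^ χ' := by
  obtain ⟨L, hL, hb⟩ := optimalWealth_holder hM hG R t ht.le
  obtain ⟨k, hk⟩ := optimalWealth_bounded hM hG R t ht.le
  have hV := isMarginalFamily_valuePair hM hG ht
  obtain ⟨H, hH0, hH⟩ := (hM t ht).optimalPosition_bounded hV k
  obtain ⟨L', hL', hb'⟩ := (hM t ht).optimalPosition_holder hV k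
  -- The first constant serves nearby paths; H + H bounds the difference of any two positions.
  refine ⟨max (L' * (1 + L)) (H + H), by positivity, fun i x₀ hx => ⟨fun e => ?_, fun e e' => ?_⟩⟩
  · exact (hH i _ _ (hk i x₀ e hx)).trans (le_trans (by linarith) (le_max_right _ _))
  · refine le_max_mul_rpow (by positivity) (by positivity) (norm_nonneg _) hχ' hχ ?_ ?_
    · refine (hb' i e e' _ _ (hk i x₀ e hx) (hk i x₀ e' hx)).trans ?_
      have := hb i x₀ e e' hx
      rw [mul_assoc]
      refine mul_le_mul_of_nonneg_left ?_ hL'.le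
      linarith
    · exact (abs_sub _ _).trans (add_le_add (hH i _ _ (hk i x₀ e hx)) (hH i _ _ (hk i x₀ e' hx)))

end Dynamic

/-! ### Verification -/

section Verification

variable {ι Ω : Type*} [MeasurableSpace Ω] {P : Measure Ω} [IsProbabilityMeasure P] {m T : ℕ}
  {η : ℕ → Ω → Factor m} {f : (t : ℕ) → Path m (t + 1) → ℝ} {G D : ι → ℝ → ℝ} {χ c α B : ℝ}

/-- The first `t` entries of a random sequence. -/
def initialPath (η : ℕ → Ω → Factor m) (t : ℕ) (ω : Ω) : Path m t :=
  WithLp.toLp 2 fun i => η i ω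

omit [IsProbabilityMeasure P] in
theorem measurable_initialPath (hη : ∀ t, Measurable (η t)) (t : ℕ) :
    Measurable (initialPath η t) := by
  unfold initialPath; fun_prop

omit [MeasurableSpace Ω] in
theorem initialPath_append (η : ℕ → Ω → Factor m) (t : ℕ) (ω : Ω) :
    (initialPath η t ω).append (η t ω) = initialPath η (t + 1) ω := by
  ext i : 1
  change (Fin.snoc (α := fun _ => Factor m) (fun i => η i ω) (η t ω) : Fin (t + 1) → Factor m) i =
    η i ω
  refine Fin.lastCases ?_ (fun j => ?_) i
  · simp
  · simp

theorem lintegral_comp_of_indepFun {X Y : Type*} [MeasurableSpace X] [MeasurableSpace Y]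
    {ξ : Ω → X} {ζ : Ω → Y} (hξ : Measurable ξ) (hζ : Measurable ζ) (hind : IndepFun ξ ζ P)
    {F : X × Y → ℝ≥0∞} (hF : Measurable F) :
    ∫⁻ ω, F (ξ ω, ζ ω) ∂P = ∫⁻ ω, ∫⁻ y, F (ξ ω, y) ∂(P.map ζ) ∂P := by
  have hmap := (indepFun_iff_map_prod_eq_prod_map_map hξ.aemeasurable hζ.aemeasurable).1 hind
  have : IsProbabilityMeasure (P.map ζ) := Measure.isProbabilityMeasure_map hζ.aemeasurable
  calc ∫⁻ ω, F (ξ ω, ζ ω) ∂P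
      = ∫⁻ p, F p ∂(P.map fun ω => (ξ ω, ζ ω)) := (lintegral_map hF (hξ.prodMk hζ)).symm
    _ = ∫⁻ x, ∫⁻ y, F (x, y) ∂(P.map ζ) ∂(P.map ξ) := by
        rw [hmap, lintegral_prod _ hF.aemeasurable]
    _ = _ := lintegral_map hF.lintegral_prod_right' hξ

theorem lintegral_initialPath_succ (hη : ∀ t, Measurable (η t)) {t : ℕ}
    (hind : IndepFun (initialPath η t) (η t) P) {F : Path m (t + 1) → ℝ≥0∞} (hF : Measurable F) :
    ∫⁻ ω, F (initialPath η (t + 1) ω) ∂P =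
      ∫⁻ ω, ∫⁻ z, F ((initialPath η t ω).append z) ∂(P.map (η t)) ∂P := by
  have h1 := measurable_initialPath hη t
  have hF' : Measurable fun p : Path m t × Factor m => F (p.1.append p.2) :=
    hF.comp Path.continuous_append.measurable
  simp only [← initialPath_append]
  exact lintegral_comp_of_indepFun h1 (hη t) hind hF'

/-- The expected distance to the upper bound `B` of the value at time `t` of the wealth reached
with the policy `g`. -/
noncomputable def expectedGap (P : Measure Ω) (η : ℕ → Ω → Factor m)
    (f : (t : ℕ) → Path m (t + 1) → ℝ) (G D : ι → ℝ → ℝ) (T : ℕ) (B : ℝ) (i : ι) (x₀ : ℝ)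
    (g : (t : ℕ) → Path m t → ℝ → ℝ) (t : ℕ) : ℝ≥0∞ :=
  ∫⁻ ω, ENNReal.ofReal (B - (valuePair T (fun t => P.map (η t)) f G D t).1 i (initialPath η t ω)
    (policyWealth f x₀ g t (initialPath η t ω))) ∂P

/-- The right side does not involve g: all policies start from the same gap, which is finite. -/
theorem expectedGap_zero (i : ι) (x₀ : ℝ) (g : (t : ℕ) → Path m t → ℝ → ℝ) :
    expectedGap P η f G D T B i x₀ g 0 = ENNReal.ofReal
      (B - (valuePair T (fun t => P.map (η t)) f G D 0).1 i 0 x₀) := by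
  have h : ∀ ω, initialPath η 0 ω = 0 := fun ω => Subsingleton.elim _ _
  simp [expectedGap, policyWealth, h]

/-- The conditional expectation, given the path up to time `t`, of the value at time `t + 1`. -/
noncomputable def continuationValue (P : Measure Ω) (η : ℕ → Ω → Factor m)
    (f : (t : ℕ) → Path m (t + 1) → ℝ) (G D : ι → ℝ → ℝ) (T : ℕ) (i : ι) (x₀ : ℝ)
    (g : (t : ℕ) → Path m t → ℝ → ℝ) (t : ℕ) (o : Path m t) : ℝ :=
  ∫ z, (valuePair T (fun t => P.map (η t)) f G D (t + 1)).1 i (o.append z)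
    (policyWealth f x₀ g t o + g t o (policyWealth f x₀ g t o) * f t (o.append z)) ∂(P.map (η t))

theorem measurable_value_policyWealth (hη : ∀ t, Measurable (η t))
    (hM : ∀ t < T, IsTransition (P.map (η t)) Path.append (f t) χ c α)
    (hG : IsMarginalFamily χ B (fun i (_ : Path m T) x => G i x) (fun i _ x => D i x))
    (i : ι) (x₀ : ℝ) {g : (t : ℕ) → Path m t → ℝ → ℝ}
    (hg : ∀ t < T, Measurable fun p : Path m t × ℝ => g t p.1 p.2) {t : ℕ} (ht : t ≤ T) :
    Measurable fun o : Path m t => ENNReal.ofReal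
      (B - (valuePair T (fun t => P.map (η t)) f G D t).1 i o (policyWealth f x₀ g t o)) := by
  have : ∀ t, IsProbabilityMeasure (P.map (η t)) := fun t =>
    Measure.isProbabilityMeasure_map (hη t).aemeasurable
  refine ENNReal.measurable_ofReal.comp (measurable_const.sub ?_)
  exact ((isMarginalFamily_valuePair hM hG ht).measurable i).comp (measurable_id.prodMk
    (measurable_policyWealth x₀ (fun t ht => (hM t ht).measurable_increment) hg t ht))

/-- The tower property: the factor of period t is independent of the path before it and is
integrated out first. Conditionally on that path the wealth is bounded, so the inner integral is an
ordinary real one. -/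
theorem expectedGap_succ (hη : ∀ t, Measurable (η t))
    (hind : ∀ t < T, IndepFun (initialPath η t) (η t) P)
    (hM : ∀ t < T, IsTransition (P.map (η t)) Path.append (f t) χ c α)
    (hG : IsMarginalFamily χ B (fun i (_ : Path m T) x => G i x) (fun i _ x => D i x))
    (i : ι) (x₀ : ℝ) {g : (t : ℕ) → Path m t → ℝ → ℝ}
    (hg : ∀ t < T, Measurable fun p : Path m t × ℝ => g t p.1 p.2) {t : ℕ} (ht : t < T) :
    expectedGap P η f G D T B i x₀ g (t + 1) = ∫⁻ ω, ENNReal.ofReal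
      (B - continuationValue P η f G D T i x₀ g t (initialPath η t ω)) ∂P := by
  have : ∀ t, IsProbabilityMeasure (P.map (η t)) := fun t =>
    Measure.isProbabilityMeasure_map (hη t).aemeasurable
  have hV := isMarginalFamily_valuePair hM hG (Nat.succ_le_of_lt ht)
  rw [expectedGap, lintegral_initialPath_succ hη (hind t ht)
    (measurable_value_policyWealth hη hM hG i x₀ hg ht)]
  refine lintegral_congr fun ω => ?_
  have hi := (hM t ht).integrable_value hV i (initialPath η t ω)
    (policyWealth f x₀ g t (initialPath η t ω))
    (g t (initialPath η t ω) (policyWealth f x₀ g t (initialPath η t ω)))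
  have hB : B - continuationValue P η f G D T i x₀ g t (initialPath η t ω) =
      ∫ z, (B - (valuePair T (fun t => P.map (η t)) f G D (t + 1)).1 i
        ((initialPath η t ω).append z) (policyWealth f x₀ g t (initialPath η t ω) +
          g t (initialPath η t ω) (policyWealth f x₀ g t (initialPath η t ω)) *
            f t ((initialPath η t ω).append z))) ∂(P.map (η t)) := by
    rw [integral_sub (integrable_const _) hi]
    simp [continuationValue]
  rw [hB]
  refine Eq.trans ?_ (ofReal_integral_eq_lintegral_ofReal ((integrable_const B).sub hi)
    (Eventually.of_forall fun z => sub_nonneg.2 (hV.le i _ _))).symm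
  refine lintegral_congr fun z => ?_
  simp only [policyWealth, Path.restrict_append, Pi.sub_apply]

section

variable (hη : ∀ t, Measurable (η t))
  (hM : ∀ t < T, IsTransition (P.map (η t)) Path.append (f t) χ c α)
  (hG : IsMarginalFamily χ B (fun i (_ : Path m T) x => G i x) (fun i _ x => D i x))
include hη hM hG

theorem continuationValue_le (i : ι) (x₀ : ℝ) (g : (t : ℕ) → Path m t → ℝ → ℝ) {t : ℕ}
    (ht : t < T) (o : Path m t) :
    continuationValue P η f G D T i x₀ g t o ≤
      (valuePair T (fun t => P.map (η t)) f G D t).1 i o (policyWealth f x₀ g t o) := by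
  have : ∀ t, IsProbabilityMeasure (P.map (η t)) := fun t =>
    Measure.isProbabilityMeasure_map (hη t).aemeasurable
  rw [valuePair, if_pos ht]
  exact (hM t ht).integral_value_le (isMarginalFamily_valuePair hM hG ht) i o _ _

theorem continuationValue_lt (i : ι) (x₀ : ℝ) (g : (t : ℕ) → Path m t → ℝ → ℝ) {t : ℕ}
    (ht : t < T) (o : Path m t) (hne : g t o (policyWealth f x₀ g t o) ≠
      optimalPolicy T (fun t => P.map (η t)) f G D i t o (policyWealth f x₀ g t o)) :
    continuationValue P η f G D T i x₀ g t o <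
      (valuePair T (fun t => P.map (η t)) f G D t).1 i o (policyWealth f x₀ g t o) := by
  have : ∀ t, IsProbabilityMeasure (P.map (η t)) := fun t =>
    Measure.isProbabilityMeasure_map (hη t).aemeasurable
  rw [valuePair, if_pos ht]
  have := (hM t ht).integral_value_lt (isMarginalFamily_valuePair hM hG ht) i o
    (policyWealth f x₀ g t o) (policyWealth f x₀ g t o) _ (Or.inr hne)
  rwa [sub_self, mul_zero, add_zero] at this

theorem measurable_optimalPolicy (i : ι) (t : ℕ) (ht : t < T) :
    Measurable fun p : Path m t × ℝ =>
      optimalPolicy T (fun t => P.map (η t)) f G D i t p.1 p.2 := by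
  have : ∀ t, IsProbabilityMeasure (P.map (η t)) := fun t =>
    Measure.isProbabilityMeasure_map (hη t).aemeasurable
  exact (continuous_optimalPolicy hM hG i ht).measurable

variable (hind : ∀ t < T, IndepFun (initialPath η t) (η t) P)
include hind

theorem expectedGap_le_succ (i : ι) (x₀ : ℝ) {g : (t : ℕ) → Path m t → ℝ → ℝ}
    (hg : ∀ t < T, Measurable fun p : Path m t × ℝ => g t p.1 p.2) {t : ℕ} (ht : t < T) :
    expectedGap P η f G D T B i x₀ g t ≤ expectedGap P η f G D T B i x₀ g (t + 1) := by
  rw [expectedGap_succ hη hind hM hG i x₀ hg ht]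
  exact lintegral_mono fun ω => ENNReal.ofReal_le_ofReal
    (sub_le_sub_left (continuationValue_le hη hM hG i x₀ g ht _) B)

theorem expectedGap_monotone (i : ι) (x₀ : ℝ) {g : (t : ℕ) → Path m t → ℝ → ℝ}
    (hg : ∀ t < T, Measurable fun p : Path m t × ℝ => g t p.1 p.2) {s t : ℕ} (hst : s ≤ t)
    (ht : t ≤ T) :
    expectedGap P η f G D T B i x₀ g s ≤ expectedGap P η f G D T B i x₀ g t := by
  induction hst with
  | refl => exact le_rfl
  | step _ ih =>
    exact (ih (Nat.le_of_succ_le ht)).trans (expectedGap_le_succ hη hM hG hind i x₀ hg ht)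

/-- Along the optimal policy the value process is a martingale: by construction the value at time t
is the continuation value of the optimal position. -/
theorem expectedGap_optimalPolicy (i : ι) (x₀ : ℝ) {t : ℕ} (ht : t ≤ T) :
    expectedGap P η f G D T B i x₀ (optimalPolicy T (fun t => P.map (η t)) f G D i) t =
      expectedGap P η f G D T B i x₀ (optimalPolicy T (fun t => P.map (η t)) f G D i) 0 := by
  induction t with
  | zero => rfl
  | succ t ih =>
    rw [← ih (Nat.le_of_succ_le ht), expectedGap_succ hη hind hM hG i x₀
      (measurable_optimalPolicy hη hM hG i) ht, expectedGap]
    refine lintegral_congr fun ω => ?_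
    rw [valuePair.eq_def _ _ _ _ _ t, if_pos (show t < T from ht)]
    rfl

theorem expectedGap_optimalPolicy_le (i : ι) (x₀ : ℝ) {g : (t : ℕ) → Path m t → ℝ → ℝ}
    (hg : ∀ t < T, Measurable fun p : Path m t × ℝ => g t p.1 p.2) :
    expectedGap P η f G D T B i x₀ (optimalPolicy T (fun t => P.map (η t)) f G D i) T ≤
      expectedGap P η f G D T B i x₀ g T := by
  rw [expectedGap_optimalPolicy hη hM hG hind i x₀ le_rfl, expectedGap_zero,
    ← expectedGap_zero (g := g)]
  exact expectedGap_monotone hη hM hG hind i x₀ hg T.zero_le le_rfl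

theorem expectedGap_optimalPolicy_ne_top (i : ι) (x₀ : ℝ) :
    expectedGap P η f G D T B i x₀ (optimalPolicy T (fun t => P.map (η t)) f G D i) T ≠ ∞ := by
  rw [expectedGap_optimalPolicy hη hM hG hind i x₀ le_rfl, expectedGap_zero]
  exact ENNReal.ofReal_ne_top

/-- A policy that is as good as the optimal policy takes the optimal positions. -/
theorem ae_eq_optimalPolicy (i : ι) (x₀ : ℝ) {g : (t : ℕ) → Path m t → ℝ → ℝ}
    (hg : ∀ t < T, Measurable fun p : Path m t × ℝ => g t p.1 p.2)
    (hle : expectedGap P η f G D T B i x₀ g T ≤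
      expectedGap P η f G D T B i x₀ (optimalPolicy T (fun t => P.map (η t)) f G D i) T)
    {t : ℕ} (ht : t < T) :
    ∀ᵐ ω ∂P, g t (initialPath η t ω) (policyWealth f x₀ g t (initialPath η t ω)) =
      optimalPolicy T (fun t => P.map (η t)) f G D i t (initialPath η t ω)
        (policyWealth f x₀ g t (initialPath η t ω)) := by
  have hV := fun {t} (ht : t ≤ T) =>
    have : ∀ t, IsProbabilityMeasure (P.map (η t)) := fun t =>
      Measure.isProbabilityMeasure_map (hη t).aemeasurable
    isMarginalFamily_valuePair hM hG ht
  have h0 : expectedGap P η f G D T B i x₀ g T ≤ expectedGap P η f G D T B i x₀ g 0 := by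
    refine hle.trans ?_
    rw [expectedGap_optimalPolicy hη hM hG hind i x₀ le_rfl, expectedGap_zero,
      ← expectedGap_zero (g := g)]
  -- The gap is non-decreasing in time and its final value does not exceed its initial one, so it is
  -- constant.
  have h1 : expectedGap P η f G D T B i x₀ g (t + 1) ≤ expectedGap P η f G D T B i x₀ g t :=
    (expectedGap_monotone hη hM hG hind i x₀ hg ht le_rfl).trans
      (h0.trans (expectedGap_monotone hη hM hG hind i x₀ hg t.zero_le ht.le))
  have h2 : expectedGap P η f G D T B i x₀ g t ≠ ∞ := by
    refine ne_top_of_le_ne_top ?_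
      ((expectedGap_monotone hη hM hG hind i x₀ hg ht.le le_rfl).trans hle)
    exact expectedGap_optimalPolicy_ne_top hη hM hG hind i x₀
  have hle' := continuationValue_le hη hM hG i x₀ g ht
  have hm : Measurable fun o => continuationValue P η f G D T i x₀ g t o := by
    have : ∀ t, IsProbabilityMeasure (P.map (η t)) := fun t =>
      Measure.isProbabilityMeasure_map (hη t).aemeasurable
    have hw := measurable_policyWealth x₀ (fun t ht => (hM t ht).measurable_increment) hg t ht.le
    have hz : Measurable fun p : Path m t × Factor m => p.1.append p.2 :=
      Path.continuous_append.measurable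
    have hw' : Measurable fun p : Path m t × Factor m => policyWealth f x₀ g t p.1 +
        g t p.1 (policyWealth f x₀ g t p.1) * f t (p.1.append p.2) :=
      (hw.comp measurable_fst).add (((hg t ht).comp (measurable_fst.prodMk
        (hw.comp measurable_fst))).mul ((hM t ht).measurable_increment.comp hz))
    exact (StronglyMeasurable.integral_prod_right (f := fun (o : Path m t) z =>
      (valuePair T (fun t => P.map (η t)) f G D (t + 1)).1 i (o.append z)
      (policyWealth f x₀ g t o + g t o (policyWealth f x₀ g t o) * f t (o.append z)))
      (((hV ht).measurable i).comp (hz.prodMk hw')).stronglyMeasurable).measurable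
  rw [expectedGap_succ hη hind hM hG i x₀ hg ht, expectedGap] at h1
  -- Ordered integrands with the same finite integral agree almost everywhere; a non-optimal
  -- position would make the continuation value strictly smaller.
  have hae := ae_eq_of_ae_le_of_lintegral_le (Eventually.of_forall fun ω =>
    ENNReal.ofReal_le_ofReal (sub_le_sub_left (hle' (initialPath η t ω)) B)) h2
    (ENNReal.measurable_ofReal.comp (measurable_const.sub
      (hm.comp (measurable_initialPath hη t)))).aemeasurable h1
  filter_upwards [hae] with ω hω
  by_contra hne
  have hlt := continuationValue_lt hη hM hG i x₀ g ht _ hne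
  have hB := (hV ht.le).le i (initialPath η t ω) (policyWealth f x₀ g t (initialPath η t ω))
  rw [ENNReal.ofReal_eq_ofReal_iff (by linarith) (by linarith)] at hω
  linarith

/-- So far the positions of g are known to be optimal only for the wealth that g itself has reached.
By forward induction this wealth is the optimal one. -/
theorem ae_eq_optimalPolicy_path (i : ι) (x₀ : ℝ) {g : (t : ℕ) → Path m t → ℝ → ℝ}
    (hg : ∀ t < T, Measurable fun p : Path m t × ℝ => g t p.1 p.2)
    (hle : expectedGap P η f G D T B i x₀ g T ≤
      expectedGap P η f G D T B i x₀ (optimalPolicy T (fun t => P.map (η t)) f G D i) T)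
    {t : ℕ} (ht : t < T) :
    ∀ᵐ ω ∂P, g t (initialPath η t ω) (policyWealth f x₀ g t (initialPath η t ω)) =
      optimalPolicy T (fun t => P.map (η t)) f G D i t (initialPath η t ω)
        (policyWealth f x₀ (optimalPolicy T (fun t => P.map (η t)) f G D i) t
          (initialPath η t ω)) := by
  have hw : ∀ t ≤ T, ∀ᵐ ω ∂P, policyWealth f x₀ g t (initialPath η t ω) =
      policyWealth f x₀ (optimalPolicy T (fun t => P.map (η t)) f G D i) t
        (initialPath η t ω) := by
    intro t
    induction t with
    | zero => exact fun _ => Eventually.of_forall fun ω => rfl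
    | succ t ih =>
      intro ht
      filter_upwards [ih (Nat.le_of_succ_le ht), ae_eq_optimalPolicy hη hM hG hind i x₀ hg hle ht]
        with ω h1 h2
      have hr : (initialPath η (t + 1) ω).restrict t t.le_succ = initialPath η t ω := rfl
      rw [policyWealth, policyWealth, hr, h2, h1]
  filter_upwards [hw t ht.le, ae_eq_optimalPolicy hη hM hG hind i x₀ hg hle ht] with ω h1 h2
  rw [h2, h1]

end

end Verification

/-! ### Expectations of random variables that are bounded from above -/

/-- Only the negative part of X can have infinite integral, and it does so exactly when B - X does.
Expectations in [-∞, ∞) are thereby compared through one non-negative integral. -/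
theorem expectation_eq_sub {Ω : Type*} [MeasurableSpace Ω] (P : Measure Ω)
    [IsProbabilityMeasure P] {X : Ω → ℝ} (hX : AEMeasurable X P) {B : ℝ} (hB : 0 ≤ B)
    (h : ∀ ω, X ω ≤ B) :
    expectation P X = (B : EReal) - ((∫⁻ ω, ENNReal.ofReal (B - X ω) ∂P : ℝ≥0∞) : EReal) := by
  have hp : ∫⁻ ω, ENNReal.ofReal (X ω) ∂P ≠ ∞ := by
    refine ne_top_of_le_ne_top (ENNReal.ofReal_ne_top (r := B))
      ((lintegral_mono fun ω => ENNReal.ofReal_le_ofReal (h ω)).trans ?_)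
    simp
  -- The integrated form of X⁺ + (B - X) = B + X⁻, which avoids subtraction of possibly infinite
  -- quantities.
  have hsum : (∫⁻ ω, ENNReal.ofReal (X ω) ∂P) + ∫⁻ ω, ENNReal.ofReal (B - X ω) ∂P =
      ENNReal.ofReal B + ∫⁻ ω, ENNReal.ofReal (-X ω) ∂P := by
    have hc : ENNReal.ofReal B = ∫⁻ _, ENNReal.ofReal B ∂P := by simp
    rw [hc, ← lintegral_add_left' hX.ennreal_ofReal, ← lintegral_add_left measurable_const]
    refine lintegral_congr fun ω => ?_
    rcases le_total 0 (X ω) with h0 | h0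
    · rw [← ENNReal.ofReal_add h0 (sub_nonneg.2 (h ω)), ENNReal.ofReal_of_nonpos (neg_nonpos.2 h0)]
      simp
    · rw [ENNReal.ofReal_of_nonpos h0, zero_add, ← ENNReal.ofReal_add hB (neg_nonneg.2 h0),
        sub_eq_add_neg]
  unfold expectation
  by_cases hn : ∫⁻ ω, ENNReal.ofReal (-X ω) ∂P = ∞
  · rw [hn, add_top, ENNReal.add_eq_top] at hsum
    rw [hn, hsum.resolve_left hp]
    simp
  · have hq : ∫⁻ ω, ENNReal.ofReal (B - X ω) ∂P ≠ ∞ := by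
      refine ne_top_of_le_ne_top (ENNReal.add_ne_top.2 ⟨ENNReal.ofReal_ne_top, hn⟩)
        (hsum ▸ le_add_self)
    have hreal := congrArg ENNReal.toReal hsum
    rw [ENNReal.toReal_add hp hq, ENNReal.toReal_add ENNReal.ofReal_ne_top hn,
      ENNReal.toReal_ofReal hB] at hreal
    rw [← ENNReal.ofReal_toReal hp, ← ENNReal.ofReal_toReal hn, ← ENNReal.ofReal_toReal hq,
      EReal.coe_ennreal_ofReal, EReal.coe_ennreal_ofReal, EReal.coe_ennreal_ofReal,
      max_eq_left ENNReal.toReal_nonneg, max_eq_left ENNReal.toReal_nonneg,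
      max_eq_left ENNReal.toReal_nonneg, ← EReal.coe_sub, ← EReal.coe_sub, EReal.coe_eq_coe_iff]
    linarith

theorem coe_sub_le_coe_sub_iff {B : ℝ} {p q : ℝ≥0∞} :
    (B : EReal) - q ≤ (B : EReal) - p ↔ p ≤ q := by
  constructor
  · intro h
    by_contra! hlt
    have hlt' : (q : EReal) < p := EReal.coe_ennreal_lt_coe_ennreal_iff.2 hlt
    exact absurd h (not_le.2 (EReal.sub_lt_sub_of_le_of_gt le_rfl hlt' (EReal.coe_ne_top B)
      (EReal.coe_ne_bot B)))
  · exact fun h => EReal.sub_le_sub le_rfl (EReal.coe_ennreal_le_coe_ennreal_iff.2 h)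

/-! ### The market as a sequence of periods -/

section Market

variable {Ω : Type*} [MeasurableSpace Ω] {P : Measure Ω} {m T : ℕ}

/-- The factors, continued by zero. -/
def extendFactors (ε : Fin T → Ω → Factor m) (t : ℕ) (ω : Ω) : Factor m :=
  if h : t < T then ε ⟨t, h⟩ ω else 0

/-- The price increments, continued by zero. -/
def extendIncrements (f : (t : Fin T) → Path m (t + 1) → ℝ) (t : ℕ) (e : Path m (t + 1)) : ℝ :=
  if h : t < T then f ⟨t, h⟩ e else 0

variable {ε : Fin T → Ω → Factor m} {f : (t : Fin T) → Path m (t + 1) → ℝ}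

theorem measurable_extendFactors (hε : ∀ t, Measurable (ε t)) (t : ℕ) :
    Measurable (extendFactors ε t) := by
  unfold extendFactors
  by_cases h : t < T
  · simpa [h] using hε ⟨t, h⟩
  · simp [h]

omit [MeasurableSpace Ω] in
theorem initialPath_extendFactors (t : Fin T) (ω : Ω) :
    initialPath (extendFactors ε) t ω = past ε t ω := by
  ext i : 1
  change extendFactors ε i ω = ε (Fin.castLE t.isLt.le i) ω
  rw [extendFactors, dif_pos (i.isLt.trans t.isLt)]
  rfl

omit [MeasurableSpace Ω] in
theorem initialPath_extendFactors_last (ω : Ω) :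
    initialPath (extendFactors ε) T ω = path ε ω := by
  ext i : 1
  change extendFactors ε i ω = ε i ω
  rw [extendFactors, dif_pos i.isLt]

omit [MeasurableSpace Ω] in
theorem initialPath_extendFactors_succ (t : Fin T) (ω : Ω) :
    initialPath (extendFactors ε) (t + 1) ω = (path ε ω).restrict (t + 1) t.isLt := by
  ext i : 1
  change extendFactors ε i ω = ε (Fin.castLE t.isLt i) ω
  rw [extendFactors, dif_pos (i.isLt.trans_le t.isLt)]
  rfl

theorem indepFun_initialPath (hε : ∀ t, Measurable (ε t)) (hind : iIndepFun ε P) {t : ℕ}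
    (ht : t < T) :
    IndepFun (initialPath (extendFactors ε) t) (extendFactors ε t) P := by
  have h := hind.indepFun_finset (Finset.univ.filter fun s : Fin T => (s : ℕ) < t) {⟨t, ht⟩}
    (by simp) hε
  let φ : ((s : (Finset.univ.filter fun s : Fin T => (s : ℕ) < t)) → Factor m) → Path m t :=
    fun x => WithLp.toLp 2 fun i => x ⟨⟨i, i.isLt.trans ht⟩, by simp⟩
  let φ' : ((s : ({⟨t, ht⟩} : Finset (Fin T))) → Factor m) → Factor m :=
    fun x => x ⟨⟨t, ht⟩, by simp⟩
  have hφ : Measurable φ := by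
    have : Measurable fun (x : (s : (Finset.univ.filter fun s : Fin T => (s : ℕ) < t)) → Factor m)
        (i : Fin t) => x ⟨⟨i, i.isLt.trans ht⟩, by simp⟩ :=
      measurable_pi_lambda _ fun i => measurable_pi_apply _
    exact (WithLp.measurable_toLp 2 _).comp this
  have hφ' : Measurable φ' := measurable_pi_apply _
  convert h.comp hφ hφ' using 1
  · funext ω
    ext i : 1
    change extendFactors ε i ω = ε ⟨i, i.isLt.trans ht⟩ ω
    rw [extendFactors, dif_pos (i.isLt.trans ht)]
  · funext ω
    change extendFactors ε t ω = ε ⟨t, ht⟩ ω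
    rw [extendFactors, dif_pos ht]

theorem continuous_of_increment_holder {E : Type*} [NormedAddCommGroup E] {g : E → ℝ} {c χ : ℝ}
    (hχ : 0 < χ) (hc : 0 < c) (hg : ∀ e e', |g e - g e'| ≤ c * ‖e - e'‖ ^ χ) : Continuous g :=
  (continuous_of_holder (G := fun e _ => g e) hχ fun _ => ⟨c, hc, fun e e' x x' _ _ =>
    (hg e e').trans (mul_le_mul_of_nonneg_left (by simp) hc.le)⟩).comp
    (continuous_id.prodMk (continuous_const (y := (0 : ℝ))))

theorem isTransition_extend (hε : ∀ t, Measurable (ε t)) {χ c α : ℝ} (hχ : 0 < χ) (hc : 0 < c)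
    (hhold : ∀ (t : Fin T) (e e' : Path m (t + 1)), |f t e - f t e'| ≤ c * ‖e - e'‖ ^ χ)
    (hbdd : ∀ (t : Fin T) (e : Path m (t + 1)), |f t e| ≤ c) (hα : 0 < α)
    (hna : ∀ (t : Fin T) (o : Path m t), α ≤ P.real {ω | α ≤ f t (o.append (ε t ω))} ∧
      α ≤ P.real {ω | f t (o.append (ε t ω)) ≤ -α}) {t : ℕ} (ht : t < T) :
    IsTransition (P.map (extendFactors ε t)) Path.append (extendIncrements f t) χ c α := by
  have hf : extendIncrements f t = f ⟨t, ht⟩ := by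
    funext e; rw [extendIncrements, dif_pos ht]
  have hη : extendFactors ε t = ε ⟨t, ht⟩ := by
    funext ω; rw [extendFactors, dif_pos ht]
  rw [hf, hη]
  have hm : Measurable (f ⟨t, ht⟩) :=
    (continuous_of_increment_holder hχ hc (hhold ⟨t, ht⟩)).measurable
  have hma (o : Path m t) : Measurable fun z => f ⟨t, ht⟩ (o.append z) :=
    hm.comp (Path.continuous_append.measurable.comp (measurable_const.prodMk measurable_id))
  refine ⟨Path.continuous_append.measurable, Path.norm_append_sub, hm, hχ, hc, hα, hbdd ⟨t, ht⟩,
    hhold ⟨t, ht⟩, fun o => ?_, fun o => ?_⟩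
  · rw [map_measureReal_apply (hε _) (measurableSet_le measurable_const (hma o))]
    exact (hna ⟨t, ht⟩ o).1
  · rw [map_measureReal_apply (hε _) (measurableSet_le (hma o) measurable_const)]
    exact (hna ⟨t, ht⟩ o).2

omit [MeasurableSpace Ω] in
theorem policyWealth_initialPath (η : ℕ → Ω → Factor m) (f : (t : ℕ) → Path m (t + 1) → ℝ)
    (x₀ : ℝ) (g : (t : ℕ) → Path m t → ℝ → ℝ) (n : ℕ) (ω : Ω) :
    policyWealth f x₀ g n (initialPath η n ω) = x₀ + ∑ t ∈ Finset.range n,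
      g t (initialPath η t ω) (policyWealth f x₀ g t (initialPath η t ω)) *
        f t (initialPath η (t + 1) ω) := by
  induction n with
  | zero => simp [policyWealth]
  | succ n ih =>
    have hr : (initialPath η (n + 1) ω).restrict n n.le_succ = initialPath η n ω := rfl
    rw [policyWealth, hr, Finset.sum_range_succ, ← add_assoc, ← ih]

/-- The terminal wealth of a strategy that follows a policy. -/
theorem terminalWealth_eq_policyWealth {S : Fin (T + 1) → Ω → ℝ}
    (hS : ∀ (t : Fin T) (ω : Ω),
      S t.succ ω - S t.castSucc ω = f t ((path ε ω).restrict (t + 1) t.isLt))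
    (x₀ : ℝ) (ψ : Strategy P ε) (g : (t : ℕ) → Path m t → ℝ → ℝ) (ω : Ω)
    (hψ : ∀ t : Fin T, ψ.position t ω = g t (past ε t ω)
      (policyWealth (extendIncrements f) x₀ g t (past ε t ω))) :
    terminalWealth S x₀ ψ ω = policyWealth (extendIncrements f) x₀ g T (path ε ω) := by
  rw [← initialPath_extendFactors_last, policyWealth_initialPath, terminalWealth,
    ← Fin.sum_univ_eq_sum_range (fun t => g t (initialPath (extendFactors ε) t ω)
      (policyWealth (extendIncrements f) x₀ g t (initialPath (extendFactors ε) t ω)) *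
        extendIncrements f t (initialPath (extendFactors ε) (t + 1) ω)) T]
  congr 1
  refine Finset.sum_congr rfl fun t _ => ?_
  rw [hψ t, hS t ω, initialPath_extendFactors, initialPath_extendFactors_succ, extendIncrements,
    dif_pos t.isLt]

theorem measurable_past_information (P : Measure Ω) (ε : Fin T → Ω → Factor m) (t : Fin T) :
    Measurable[information P ε t] (past ε t) := by
  have h : Measurable[⨆ (s : Fin T) (_ : (s : ℕ) < t), MeasurableSpace.comap (ε s) inferInstance]
      (past ε t) := by
    refine (WithLp.measurable_toLp 2 _).comp ?_
    refine @measurable_pi_lambda _ _ _ (_) _ _ fun i => ?_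
    have hi : ((Fin.castLE t.isLt.le i : Fin T) : ℕ) < t := i.isLt
    exact (comap_measurable (ε (Fin.castLE t.isLt.le i))).mono (le_iSup₂_of_le _ hi le_rfl) le_rfl
  exact h.mono le_eventuallyMeasurableSpace le_rfl

/-- The strategy given by Borel functions of the past. -/
def strategyOfPast (P : Measure Ω) (ε : Fin T → Ω → Factor m) (h : (t : Fin T) → Path m t → ℝ)
    (hh : ∀ t, Measurable (h t)) : Strategy P ε where
  position t ω := h t (past ε t ω)
  predictable t := (hh t).comp (measurable_past_information P ε t)

/-- A strategy as a policy that does not look at the current wealth. -/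
noncomputable def Strategy.policy (ψ : Strategy P ε) (t : ℕ) (o : Path m t) (_ : ℝ) : ℝ :=
  if h : t < T then ψ.doob ⟨t, h⟩ o else 0

theorem Strategy.measurable_doob (ψ : Strategy P ε) (t : Fin T) : Measurable (ψ.doob t) :=
  (Classical.choose_spec (ψ.exists_doob t)).1

theorem Strategy.position_ae_eq_doob (ψ : Strategy P ε) (t : Fin T) :
    ψ.position t =ᵐ[P] fun ω => ψ.doob t (past ε t ω) :=
  (Classical.choose_spec (ψ.exists_doob t)).2

theorem Strategy.measurable_policy (ψ : Strategy P ε) (t : ℕ) (ht : t < T) :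
    Measurable fun p : Path m t × ℝ => ψ.policy t p.1 p.2 := by
  simp only [policy, dif_pos ht]
  exact (ψ.measurable_doob ⟨t, ht⟩).comp measurable_fst

theorem Strategy.position_ae_eq_policy (ψ : Strategy P ε) :
    ∀ᵐ ω ∂P, ∀ (t : Fin T) x, ψ.position t ω = ψ.policy t (past ε t ω) x := by
  filter_upwards [ae_all_iff.2 fun t => ψ.position_ae_eq_doob t] with ω hω t x
  rw [hω t, policy, dif_pos t.isLt]

theorem measurable_referencePoint {copy : Ω → Path m T}
    (hf : ∀ t, Measurable (f t)) (x₀ : ℝ) (φ : Strategy P ε) :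
    ∃ ρ : Path m T → ℝ, Measurable ρ ∧
      referencePoint f copy x₀ φ = fun ω => ρ (copy ω) := by
  refine ⟨fun e => x₀ + ∑ t : Fin T, φ.doob t (e.restrict t t.isLt.le) *
    f t (e.restrict (t + 1) t.isLt), ?_, rfl⟩
  refine measurable_const.add (Finset.measurable_fun_sum _ fun t _ => ?_)
  exact ((φ.measurable_doob t).comp (Path.continuous_restrict t t.isLt.le).measurable).mul
    ((hf t).comp (Path.continuous_restrict _ t.isLt).measurable)

/-- Since the reference point is independent of the market, its law can be integrated out. -/
theorem lintegral_satisfaction_eq [IsProbabilityMeasure P] {U ν : ℝ → ℝ} (hU : IsUtility U)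
    (hν : IsGainLoss ν) {B : ℝ} (hB : ∀ x b, satisfaction U ν x b ≤ B)
    (hbdd : ∀ x, ∃ k, ∀ b, |satisfaction U ν x b| ≤ k)
    {E : Type*} [MeasurableSpace E] {ξ : Ω → E} (hξ : Measurable ξ) {b : Ω → ℝ}
    (hb : Measurable b) (hind : IndepFun ξ b P) {w : E → ℝ} (hw : Measurable w) :
    ∫⁻ ω, ENNReal.ofReal (B - satisfaction U ν (w (ξ ω)) (b ω)) ∂P =
      ∫⁻ ω, ENNReal.ofReal (B - ∫ y, satisfaction U ν (w (ξ ω)) y ∂(P.map b)) ∂P := by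
  have : IsProbabilityMeasure (P.map b) := Measure.isProbabilityMeasure_map hb.aemeasurable
  have hF : Measurable fun p : E × ℝ => ENNReal.ofReal (B - satisfaction U ν (w p.1) p.2) :=
    ENNReal.measurable_ofReal.comp (measurable_const.sub
      ((measurable_satisfaction hU hν).comp ((hw.comp measurable_fst).prodMk measurable_snd)))
  rw [lintegral_comp_of_indepFun hξ hb hind hF]
  refine lintegral_congr fun ω => ?_
  obtain ⟨k, hk⟩ := hbdd (w (ξ ω))
  have hi : Integrable (fun y => satisfaction U ν (w (ξ ω)) y) (P.map b) :=
    integrable_of_measurable_of_abs_le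
      ((measurable_satisfaction hU hν).comp (measurable_const.prodMk measurable_id)) hk
  have hint : B - ∫ y, satisfaction U ν (w (ξ ω)) y ∂(P.map b) =
      ∫ y, (B - satisfaction U ν (w (ξ ω)) y) ∂(P.map b) := by
    rw [integral_sub (integrable_const _) hi]
    simp
  rw [hint]
  exact (ofReal_integral_eq_lintegral_ofReal ((integrable_const B).sub hi)
    (Eventually.of_forall fun y => sub_nonneg.2 (hB _ y))).symm

end Market

/-- The admissible constants at x form a convex set, since they are closed upwards, and nearby
points share an admissible constant. A partition of unity then yields a continuous selection. -/
theorem exists_continuous_of_locally_uniform {p : ℝ → ℝ → Prop}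
    (hmono : ∀ x c c', c ≤ c' → p x c → p x c')
    (h : ∀ R, ∃ c > 0, ∀ x, |x| ≤ R → p x c) :
    ∃ C : ℝ → ℝ, Continuous C ∧ (∀ x, 0 < C x) ∧ ∀ x, p x (C x) := by
  obtain ⟨C, hC⟩ := exists_continuous_forall_mem_convex_of_local_const
    (t := fun x => {c : ℝ | 0 < c ∧ p x c})
    (fun x => Set.OrdConnected.convex ⟨fun a ha b _ c hc =>
      ⟨ha.1.trans_le hc.1, hmono x a c hc.1 ha.2⟩⟩)
    (fun x => by
      obtain ⟨c, hc, hp⟩ := h (|x| + 1)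
      refine ⟨c, ?_⟩
      have : ∀ᶠ y in nhds x, |y| < |x| + 1 :=
        continuous_abs.continuousAt.eventually_lt continuousAt_const (by simp)
      filter_upwards [this] with y hy using ⟨hc, hp y hy.le⟩)
  exact ⟨C, C.continuous, fun x => (hC x).1, fun x => (hC x).2⟩

end RefMarket

/-! ### Assembly: reduction to the averaged problem, optimality and uniqueness -/

theorem proposition3p2 {Ω : Type*} [MeasurableSpace Ω] (P : Measure Ω) [IsProbabilityMeasure P]
    {m T : ℕ} (hm : 1 ≤ m) (hT : 1 ≤ T)
    (ε : Fin T → Ω → RefMarket.Factor m) (εhat : Ω → unitInterval)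
    (hε : RefMarket.IsFactorModel P ε εhat)
    (S : Fin (T + 1) → Ω → ℝ) (f : (t : Fin T) → RefMarket.Path m (t + 1) → ℝ) (χ : ℝ)
    (hS : RefMarket.IsPriceModel ε S f χ)
    (hf : RefMarket.UniformNoArbitrage P ε f)
    (U ν : ℝ → ℝ) (hU : RefMarket.IsUtility U) (hν : RefMarket.IsGainLoss ν)
    (Υ : unitInterval → RefMarket.Path m T) (hΥ : Measurable Υ)
    (hΥlaw : Measure.map (fun ω => Υ (εhat ω)) P = Measure.map (RefMarket.path ε) P) :
    ∃ C : ℝ → ℝ, Continuous C ∧ (∀ x, 0 < C x) ∧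
      ∀ (x₀ : ℝ) (φ : RefMarket.Strategy P ε), ∃ ψ : RefMarket.Strategy P ε,
        RefMarket.IsOptimizer U ν S f (fun ω => Υ (εhat ω)) x₀ φ ψ ∧
        Integrable (RefMarket.payoff U ν S f (fun ω => Υ (εhat ω)) x₀ φ ψ) P ∧
        (∀ ψ' : RefMarket.Strategy P ε,
          RefMarket.IsOptimizer U ν S f (fun ω => Υ (εhat ω)) x₀ φ ψ' →
            ∀ t, ψ'.position t =ᵐ[P] ψ.position t) ∧
        ∃ ψbar : (t : Fin T) → RefMarket.Path m t → ℝ,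
          (∀ t, Measurable (ψbar t)) ∧
          (∀ t ω, ψ.position t ω = ψbar t (RefMarket.past ε t ω)) ∧
          (∀ t e, |ψbar t e| ≤ C x₀) ∧
          ∀ t e e', |ψbar t e - ψbar t e'| ≤ C x₀ * ‖e - e'‖ ^ (χ / 2 ^ (T - (t : ℕ))) := by

  obtain ⟨cf, hcf, hhold, hbdd⟩ := hS.holder_bounded
  obtain ⟨α, hα, -, hna⟩ := hf
  obtain ⟨B, hB0, hsat⟩ :=
    RefMarket.isMarginalFamily_satisfaction (E := RefMarket.Path m T) hU hν χ
  have hχ := hS.exponent_pos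
  have hfm : ∀ t, Measurable (f t) := fun t =>
    (RefMarket.continuous_of_increment_holder hχ hcf (hhold t)).measurable
  have hsatle : ∀ x b, RefMarket.satisfaction U ν x b ≤ B := fun x b => hsat.le b 0 x
  have hpath : Measurable (RefMarket.path ε) := by
    have := hε.measurable
    unfold RefMarket.path
    fun_prop
  set copy : Ω → RefMarket.Path m T := fun ω => Υ (εhat ω)
  -- The index contains x₀ as well as φ because the reference point starts from x₀. Uniformity over
  -- the index is what makes the final constant independent of φ.
  let b : ℝ × RefMarket.Strategy P ε → Ω → ℝ := fun i =>
    RefMarket.referencePoint f copy i.1 i.2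
  have hb : ∀ i, Measurable (b i) ∧ IndepFun (RefMarket.path ε) (b i) P := fun i => by
    obtain ⟨ρ, hρ, hρeq⟩ := RefMarket.measurable_referencePoint (copy := copy) hfm i.1 i.2
    have hbi : b i = (ρ ∘ Υ) ∘ εhat := hρeq
    rw [hbi]
    exact ⟨(hρ.comp hΥ).comp hε.measurable_hat,
      (hε.indep_hat.comp (hρ.comp hΥ) measurable_id).symm⟩
  have hprob : ∀ i, IsProbabilityMeasure (P.map (b i)) := fun i =>
    Measure.isProbabilityMeasure_map (hb i).1.aemeasurable
  let G : ℝ × RefMarket.Strategy P ε → ℝ → ℝ := fun i x =>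
    ∫ y, RefMarket.satisfaction U ν x y ∂(P.map (b i))
  let D : ℝ × RefMarket.Strategy P ε → ℝ → ℝ := fun i x =>
    ∫ y, RefMarket.marginalSatisfaction U ν x y ∂(P.map (b i))
  have hG : RefMarket.IsMarginalFamily χ B (fun i (_ : RefMarket.Path m T) x => G i x)
      (fun i _ x => D i x) :=
    hsat.average ((RefMarket.measurable_satisfaction hU hν).comp
        ((measurable_snd.comp measurable_fst).prodMk measurable_snd))
      (fun _ x => (RefMarket.measurable_marginalSatisfaction hU hν).comp
        (measurable_const.prodMk measurable_id)) fun i => P.map (b i)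
  let η := RefMarket.extendFactors ε
  let F := RefMarket.extendIncrements f
  have hη : ∀ t, Measurable (η t) := RefMarket.measurable_extendFactors hε.measurable
  have hηprob : ∀ t, IsProbabilityMeasure (P.map (η t)) := fun t =>
    Measure.isProbabilityMeasure_map (hη t).aemeasurable
  have hM : ∀ t < T, RefMarket.IsTransition (P.map (η t)) RefMarket.Path.append (F t) χ cf α :=
    fun t ht => RefMarket.isTransition_extend hε.measurable hχ hcf hhold hbdd hα hna ht
  have hind : ∀ t < T, IndepFun (RefMarket.initialPath η t) (η t) P := fun t ht =>
    RefMarket.indepFun_initialPath hε.measurable hε.indep ht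
  let π := fun i => RefMarket.optimalPolicy T (fun t => P.map (η t)) F G D i
  let ψbar : ∀ (x₀ : ℝ) (φ : RefMarket.Strategy P ε) (t : Fin T), RefMarket.Path m t → ℝ :=
    fun x₀ φ t e => π (x₀, φ) t e (RefMarket.policyWealth F x₀ (π (x₀, φ)) t e)
  have hπm : ∀ i, ∀ t < T, Measurable fun p : RefMarket.Path m t × ℝ => π i t p.1 p.2 :=
    fun i t ht => RefMarket.measurable_optimalPolicy hη hM hG i t ht
  have hFm : ∀ t < T, Measurable (F t) := fun t ht => (hM t ht).measurable_increment
  have hψm : ∀ x₀ φ t, Measurable (ψbar x₀ φ t) := fun x₀ φ t =>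
    (hπm (x₀, φ) t t.isLt).comp (measurable_id.prodMk
      (RefMarket.measurable_policyWealth x₀ hFm (hπm (x₀, φ)) t t.isLt.le))
  obtain ⟨C, hCc, hC0, hC⟩ := RefMarket.exists_continuous_of_locally_uniform
    (p := fun x₀ c => ∀ φ t, (∀ e, |ψbar x₀ φ t e| ≤ c) ∧
      ∀ e e', |ψbar x₀ φ t e - ψbar x₀ φ t e'| ≤ c * ‖e - e'‖ ^ (χ / 2 ^ (T - (t : ℕ))))
    (fun x₀ c c' hcc h φ t => ⟨fun e => ((h φ t).1 e).trans hcc, fun e e' =>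
      ((h φ t).2 e e').trans (mul_le_mul_of_nonneg_right hcc (by positivity))⟩)
    (fun R => by
      -- Periods are counted from 0 here, so T - t is the usual T - t + 1. Only χ' ≤ χ matters for
      -- the exponent.
      have h := fun t : Fin T => RefMarket.optimalPolicy_path_bounds hM hG R t.isLt
        (χ' := χ / 2 ^ (T - (t : ℕ))) (by positivity)
        (div_le_self hχ.le (one_le_pow₀ (by norm_num)))
      choose c hc0 hc using h
      refine ⟨∑ t, c t + 1, add_pos_of_nonneg_of_pos
        (Finset.sum_nonneg fun t _ => (hc0 t).le) one_pos, fun x₀ hx φ t => ?_⟩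
      have hct : c t ≤ ∑ t, c t + 1 :=
        (Finset.single_le_sum (fun t _ => (hc0 t).le) (Finset.mem_univ t)).trans (by linarith)
      obtain ⟨h1, h2⟩ := hc t (x₀, φ) x₀ hx
      exact ⟨fun e => (h1 e).trans hct, fun e e' =>
        (h2 e e').trans (mul_le_mul_of_nonneg_right hct (by positivity))⟩)
  refine ⟨C, hCc, hC0, fun x₀ φ => ?_⟩
  have hwm : ∀ g : (t : ℕ) → RefMarket.Path m t → ℝ → ℝ,
      (∀ t < T, Measurable fun p : RefMarket.Path m t × ℝ => g t p.1 p.2) →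
      Measurable (RefMarket.policyWealth F x₀ g T) := fun g hg =>
    RefMarket.measurable_policyWealth x₀ hFm hg T le_rfl
  -- Translates expected payoffs into terminal gaps. The policy g may look at wealth, as the optimal
  -- one does, or ignore it, as the Doob representation of an arbitrary competitor does.
  have key : ∀ (ψ : RefMarket.Strategy P ε) (g : (t : ℕ) → RefMarket.Path m t → ℝ → ℝ),
      (∀ t < T, Measurable fun p : RefMarket.Path m t × ℝ => g t p.1 p.2) →
      (∀ᵐ ω ∂P, ∀ t : Fin T, ψ.position t ω = g t (RefMarket.past ε t ω)
        (RefMarket.policyWealth F x₀ g t (RefMarket.past ε t ω))) →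
      AEMeasurable (RefMarket.payoff U ν S f copy x₀ φ ψ) P ∧
      RefMarket.expectation P (RefMarket.payoff U ν S f copy x₀ φ ψ) =
        (B : EReal) - ((RefMarket.expectedGap P η F G D T B (x₀, φ) x₀ g T : ℝ≥0∞) : EReal) := by
    intro ψ g hg hψ
    have hae : RefMarket.payoff U ν S f copy x₀ φ ψ =ᵐ[P] fun ω => RefMarket.satisfaction U ν
        (RefMarket.policyWealth F x₀ g T (RefMarket.path ε ω)) (b (x₀, φ) ω) := by
      filter_upwards [hψ] with ω hω
      rw [RefMarket.payoff,
        RefMarket.terminalWealth_eq_policyWealth hS.increment x₀ ψ g ω hω]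
    have hmeas : AEMeasurable (RefMarket.payoff U ν S f copy x₀ φ ψ) P :=
      ⟨_, (RefMarket.measurable_satisfaction hU hν).comp
        (((hwm g hg).comp hpath).prodMk (hb (x₀, φ)).1), hae⟩
    refine ⟨hmeas, ?_⟩
    rw [RefMarket.expectation_eq_sub P hmeas hB0 fun ω => hsatle _ _]
    congr 2
    rw [lintegral_congr_ae (hae.mono fun ω hω => by rw [hω]),
      RefMarket.lintegral_satisfaction_eq hU hν hsatle (fun x => by
        obtain ⟨k, hk⟩ := hsat.bounded |x|
        exact ⟨k, fun y => hk y 0 x le_rfl⟩) hpath (hb (x₀, φ)).1 (hb (x₀, φ)).2 (hwm g hg),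
      RefMarket.expectedGap, RefMarket.valuePair, if_neg (lt_irrefl T)]
    simp only [η, RefMarket.initialPath_extendFactors_last]
    rfl
  have hkey' : ∀ ψ : RefMarket.Strategy P ε, _ := fun ψ => key ψ ψ.policy ψ.measurable_policy
    (ψ.position_ae_eq_policy.mono fun ω hω t => hω t _)
  let ψ := RefMarket.strategyOfPast P ε (ψbar x₀ φ) (hψm x₀ φ)
  have hkey := key ψ (π (x₀, φ)) (hπm (x₀, φ)) (Eventually.of_forall fun ω t => rfl)
  have hopt : RefMarket.IsOptimizer U ν S f copy x₀ φ ψ := by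
    refine le_antisymm (le_iSup
      (fun ψ => RefMarket.expectation P (RefMarket.payoff U ν S f copy x₀ φ ψ)) ψ)
      (iSup_le fun ψ' => ?_)
    rw [(hkey' ψ').2, hkey.2]
    exact RefMarket.coe_sub_le_coe_sub_iff.2 (RefMarket.expectedGap_optimalPolicy_le hη hM hG hind
      (x₀, φ) x₀ ψ'.measurable_policy)
  refine ⟨ψ, hopt, ?_, fun ψ' hψ' t => ?_, ψbar x₀ φ, hψm x₀ φ, fun t ω => rfl,
    fun t => (hC x₀ φ t).1, fun t => (hC x₀ φ t).2⟩
  -- Optimal terminal wealth is bounded, and satisfaction on a bounded set of wealths is bounded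
  -- uniformly in the reference level, so the payoff is bounded even if the reference point is not.
  · obtain ⟨k, hk⟩ := RefMarket.optimalWealth_bounded hM hG |x₀| T le_rfl
    obtain ⟨k', hk'⟩ := hsat.bounded k
    refine Integrable.of_bound hkey.1.aestronglyMeasurable k' (Eventually.of_forall fun ω => ?_)
    rw [RefMarket.payoff, RefMarket.terminalWealth_eq_policyWealth hS.increment x₀ ψ (π (x₀, φ)) ω
      fun t => rfl]
    exact hk' _ 0 _ (hk (x₀, φ) x₀ _ le_rfl)
  · have hle : RefMarket.expectedGap P η F G D T B (x₀, φ) x₀ ψ'.policy T ≤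
        RefMarket.expectedGap P η F G D T B (x₀, φ) x₀ (π (x₀, φ)) T := by
      rw [← RefMarket.coe_sub_le_coe_sub_iff (B := B), ← hkey.2, ← (hkey' ψ').2]
      exact (hopt.trans hψ'.symm).le
    filter_upwards [RefMarket.ae_eq_optimalPolicy_path hη hM hG hind (x₀, φ) x₀
      ψ'.measurable_policy hle t.isLt, ψ'.position_ae_eq_policy] with ω h1 h2
    have hp : RefMarket.initialPath η t ω = RefMarket.past ε t ω :=
      RefMarket.initialPath_extendFactors t ω
    rw [hp] at h1
    rw [h2 t, h1]
    rfl
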